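/- Let $q=p^a\ge 3$ with $p$ prime and $a\ge 1$, let $\omega$ be a generator of $\mathbb{F}_{q^2}^*$, and let $r>1$ be a divisor of $q^2-1$. Let $V=\mathbb{F}_{q^2}^3$ with basis $e,x,f$ and the unitary form $$(u,v)=u_1v_3^q+u_2v_2^q+u_3v_1^q,$$ where coordinates are taken with respect to $e,x,f$ (so $(e,e)=(f,f)=(x,e)=(x,f)=0$ and $(x,x)=(e,f)=1$). Let $Z$ be the group of nonzero scalars on $V$, let $\mathrm{SU}_3(q)$ be the group of linear isometries of the form of determinant $1$, and let $\Gamma\mathrm{U}_3(q)$ be the group of semisimilarities, that is, of semilinear bijections $g$ of $V$ for which there are $\lambda\in\mathbb{F}_{q^2}^*$ and $\theta\in\mathrm{Aut}(\mathbb{F}_{q^2})$ with $(ug,vg)=\lambda (u,v)^{\theta}$ for all $u,v\in V$. Let $\Omega=\{\langle\omega^r\rangle v : 0\ne v\in V,\ (v,v)=0\}$, on which $\Gamma\mathrm{U}_3(q)$ acts naturally. For $\langle\omega^r\rangle v\in\Omega$ put $\sigma_{\langle\omega^r\rangle v}=\{\langle\omega^r\rangle\omega^i v : 0\le i<r\}$.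 Let $\alpha=\langle\omega^r\rangle e$ and $\sigma=\sigma_\alpha$. For a set $S$ of vectors write $\langle\omega^r\rangle S=\{\langle\omega^r\rangle v : v\in S\}$. **Theorem.** Let $Z\,\mathrm{SU}_3(q)\le G\le\Gamma\mathrm{U}_3(q)$ be such that the permutation group induced by $G$ on $\Omega$ is transitive of rank $3$ (a point stabiliser has exactly three orbits on $\Omega$). Let $B$ be a block of imprimitivity for the action of $G_\alpha$ on $\Omega\setminus\sigma$ that contains $\langle\omega^r\rangle f$ and is nontrivial, that is, $|B|>1$ and $B\ne\Omega\setminus\sigma$. Then one of the following holds. 1. $B=B_1=\langle\omega^r\rangle\{f+v : v\in\langle x,e\rangle,\ (f+v,f+v)=0\}$, and $|B|=q^3$. 2. $B=B_2=\langle\omega^r\rangle\{f+be : b\in\mathbb{F}_{q^2},\ b+b^q=0\}$, and $|B|=q$. 3. $B=B_3=\langle\omega^r\rangle\{f,\omega f,\ldots,\omega^{r-1}f\}$, and $|B|=r$. 4. $B=B_4=\bigcup_{\gamma\in B_2}\sigma_\gamma$, and $|B|=qr$. 5. $(q,r)=(4,3)$, $G=\Gamma\mathrm{U}_3(4)$,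 and either $B=B_5=\langle\omega^r\rangle\{\lambda f+(1-\lambda)e : \lambda\in\mathbb{F}_4^*\}$ and $|B|=3$, or $B=B_6=\langle\omega^r\rangle\{f,f+e\}$ and $|B|=2$. 6. $(q,r)=(16,5)$, $G=\Gamma\mathrm{U}_3(16)$, $B=B_7=\langle\omega^r\rangle\{f+\lambda e : \lambda\in\mathbb{F}_4\}$, and $|B|=4$. -/

import Mathlib

open scoped Pointwise

namespace UnitaryRankThree

/-! ### Permutation groups -/

/-- The group `G` acts transitively on the nonempty set `X`, and every point stabiliser
has exactly `n` orbits in `X`; that is, the group induced by `G` on `X` is transitive of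
rank `n`. -/
def HasRank (G : Type*) {T : Type*} [Group G] [MulAction G T] (X : Set T) (n : ℕ) : Prop :=
  X.Nonempty ∧ (∀ x ∈ X, MulAction.orbit G x = X) ∧
    ∀ x ∈ X, {O : Set T | ∃ y ∈ X, O = MulAction.orbit (MulAction.stabilizer G x) y}.ncard = n

section Groups

variable (K : Type*) [Field K] (q : ℕ)

/-- Coordinate vectors over `K` (in the theorem `K` is the field of order `q ^ 2`), with
respect to the basis `e, x, f`. -/
abbrev V : Type _ := Fin 3 → K

variable {K}

/-- The unitary form, with Gram matrix `((0, 0, 1), (0, 1, 0), (1, 0, 0))` in the basis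
`e, x, f`. -/
def form (u v : V K) : K := u 0 * v 2 ^ q + u 1 * v 1 ^ q + u 2 * v 0 ^ q

variable (K)

/-- The first vector of the standard hyperbolic basis. -/
def e : V K := ![1, 0, 0]

/-- The second vector of the standard hyperbolic basis. -/
def x : V K := ![0, 1, 0]

/-- The third vector of the standard hyperbolic basis. -/
def f : V K := ![0, 0, 1]

/-- The general unitary group: the linear isometries of the form. -/
def GU : Subgroup (V K ≃ₗ[K] V K) where
  carrier := {g | ∀ u v, form q (g u) (g v) = form q u v}
  mul_mem' := by
    intro g h hg hh u v
    rw [LinearEquiv.mul_apply, LinearEquiv.mul_apply, hg, hh]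
  one_mem' := fun _ _ => rfl
  inv_mem' := by
    intro g hg u v
    have h1 := hg (g⁻¹ u) (g⁻¹ v)
    have h2 : ∀ w, g (g⁻¹ w) = w := fun w => g.apply_symm_apply w
    rw [h2, h2] at h1
    exact h1.symm

/-- The special unitary group. -/
noncomputable def SU : Subgroup (V K ≃ₗ[K] V K) := GU K q ⊓ LinearEquiv.det.ker

/-- The group `Z · SU`, where `Z` is the group of nonzero scalars, as a group of permutations
of the set of vectors (`Z` is central in the general linear group, so the join is the
product). -/
noncomputable def ZSU : Subgroup (Equiv.Perm (V K)) :=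
  (MulAction.toPermHom Kˣ (V K)).range ⊔
    (SU K q).map (MulAction.toPermHom (V K ≃ₗ[K] V K) (V K))

/-- The group of semisimilarities of the unitary space: the semilinear bijections `g` for
which there are `c ≠ 0` and a field automorphism `θ` with
`form (g u) (g v) = c * θ (form u v)` for all `u, v`. -/
def GammaU : Subgroup (Equiv.Perm (V K)) where
  carrier := {g | (∀ u v : V K, g (u + v) = g u + g v) ∧
    (∃ τ : K ≃+* K, ∀ (c : K) (v : V K), g (c • v) = τ c • g v) ∧
    ∃ c : K, c ≠ 0 ∧ ∃ θ : K ≃+* K, ∀ u v, form q (g u) (g v) = c * θ (form q u v)}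
  mul_mem' := by
    rintro g h ⟨ag, ⟨τ, hτ⟩, c, hc, θ, hθ⟩ ⟨ah, ⟨τ', hτ'⟩, c', hc', θ', hθ'⟩
    refine ⟨fun u v => ?_, ⟨τ'.trans τ, fun d v => ?_⟩, c * θ c', ?_, θ'.trans θ, fun u v => ?_⟩
    · simp only [Equiv.Perm.mul_apply, ah, ag]
    · simp only [Equiv.Perm.mul_apply, hτ', hτ, RingEquiv.coe_trans, Function.comp_apply]
    · exact mul_ne_zero hc ((map_ne_zero_iff θ θ.injective).2 hc')
    · simp only [Equiv.Perm.mul_apply, hθ, hθ', map_mul, RingEquiv.coe_trans,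
        Function.comp_apply, mul_assoc]
  one_mem' := ⟨fun _ _ => rfl, ⟨RingEquiv.refl K, fun _ _ => rfl⟩, 1, one_ne_zero,
    RingEquiv.refl K, fun u v => by simp⟩
  inv_mem' := by
    rintro g ⟨ag, ⟨τ, hτ⟩, c, hc, θ, hθ⟩
    have h2 : ∀ w, g (g⁻¹ w) = w := fun w => g.apply_symm_apply w
    refine ⟨fun u v => g.injective ?_, ⟨τ.symm, fun d v => g.injective ?_⟩, θ.symm c⁻¹, ?_,
      θ.symm, fun u v => ?_⟩
    · rw [h2, ag, h2, h2]
    · rw [h2, hτ, h2, RingEquiv.apply_symm_apply]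
    · exact (map_ne_zero_iff θ.symm θ.symm.injective).2 (inv_ne_zero hc)
    · have h1 := hθ (g⁻¹ u) (g⁻¹ v)
      rw [h2, h2] at h1
      rw [← map_mul, h1, inv_mul_cancel_left₀ hc, RingEquiv.symm_apply_apply]

end Groups

section Points

variable {K : Type*} [Field K] (q : ℕ) (ω : Kˣ) (r : ℕ)

/-- The set `⟨ω ^ r⟩ v` of vectors. -/
def pt (v : V K) : Set (V K) := {w | ∃ μ ∈ Subgroup.zpowers (ω ^ r), w = μ • v}

/-- The set `Ω` of all `⟨ω ^ r⟩ v` with `v` nonzero and isotropic. -/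
def Omega : Set (Set (V K)) := {S | ∃ v : V K, v ≠ 0 ∧ form q v v = 0 ∧ S = pt ω r v}

/-- The part `σ(⟨v⟩) = {⟨ω ^ r⟩ ω ^ i v | 0 ≤ i < r}` of the partition `Σ` of `Ω`. -/
def cell (v : V K) : Set (Set (V K)) := {S | ∃ i < r, S = pt ω r (ω ^ i • v)}

/-- `B₁ = ⟨ω ^ r⟩ {f + v | v ∈ ⟨x, e⟩, (f + v, f + v) = 0}`. -/
def B1 : Set (Set (V K)) :=
  {S | ∃ v ∈ Submodule.span K {x K, e K}, form q (f K + v) (f K + v) = 0 ∧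
    S = pt ω r (f K + v)}

/-- `B₂ = ⟨ω ^ r⟩ {f + b e | b + b ^ q = 0}`. -/
def B2 : Set (Set (V K)) := {S | ∃ b : K, b + b ^ q = 0 ∧ S = pt ω r (f K + b • e K)}

/-- `B₃ = ⟨ω ^ r⟩ {f, ω f, …, ω ^ (r - 1) f}`. -/
def B3 : Set (Set (V K)) := {S | ∃ i < r, S = pt ω r (ω ^ i • f K)}

/-- `B₄`, the union of the parts of `Σ` that contain a point of `B₂`. -/
def B4 : Set (Set (V K)) := ⋃ b ∈ {b : K | b + b ^ q = 0}, cell ω r (f K + b • e K)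

/-- `B₅ = ⟨ω ^ r⟩ {c f + (1 - c) e | c ∈ 𝔽₄, c ≠ 0}`; here and in `B7` the subfield `𝔽₄` is
the set of solutions of `c ^ 4 = c`. -/
def B5 : Set (Set (V K)) :=
  {S | ∃ c : K, c ^ 4 = c ∧ c ≠ 0 ∧ S = pt ω r (c • f K + (1 - c) • e K)}

/-- `B₆ = ⟨ω ^ r⟩ {f, f + e}`. -/
def B6 : Set (Set (V K)) := {pt ω r (f K), pt ω r (f K + e K)}

/-- `B₇ = ⟨ω ^ r⟩ {f + c e | c ∈ 𝔽₄}`. -/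
def B7 : Set (Set (V K)) := {S | ∃ c : K, c ^ 4 = c ∧ S = pt ω r (f K + c • e K)}

end Points

end UnitaryRankThree

namespace UnitaryRankThree

/-! ### The quadratic extension of finite fields -/

/-! A point outside σ has the form ⟨ω^r⟩κ(f + sx + te) with s^(q+1) + t + t^q = 0, where s and t are
unique and κ is unique modulo r-th powers. The stabiliser of ⟨ω^r⟩e in Z·SU acts on such triples by
an explicit affine formula, and an element carrying one point of B into B preserves B. So B becomes
a relation D κ s t closed under these moves (`AffineBlock`), and such relations are classified.

Rank 3 supplies the arithmetic (`admissible_of_hasRank`). An element of G fixing ⟨ω^r⟩e moves ωe to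
another multiple modulo r-th powers only through its Frobenius part, so powers of p meet all nonzero
classes modulo r. Hence r is an odd prime, r - 1 divides a, and r divides q - 1 but not q + 1.

`AffineBlock.classification` asks whether D contains a κ that is not an r-th power, a nonzero s, or
a nonzero t over κ = 1. Scaling by torus elements makes the sets of s and of t stable under r-th
powers of K and of 𝔽_q respectively, and a subring containing all r-th powers is the whole field
unless that field has fewer than r^2 elements (`subring_eq_top_of_pow_mem`). For K this exception
never occurs, as r < q. The regular outcomes are B₁ to B₄. The leftovers need q < r^2, which leaves
(q, r) = (4, 3) and (16, 5) (`exceptional_parameters`). There G must be all of ΓU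
(`eq_GammaU_of_hasRank`), so D is also Frobenius-stable, and computations in 𝔽₄ and 𝔽₁₆ finish the
proof. -/

/-- `K` is a field of order `q ^ 2` on which `y ↦ y ^ q` is an additive involution. -/
structure IsQuadratic (K : Type*) [Field K] (q : ℕ) : Prop where
  two_le : 2 ≤ q
  card : Nat.card K = q ^ 2
  add_pow : ∀ y z : K, (y + z) ^ q = y ^ q + z ^ q
  pow_pow : ∀ y : K, (y ^ q) ^ q = y

theorem charP_of_card {K : Type*} [Field K] [Finite K] {p n : ℕ} (hp : p.Prime)
    (hK : Nat.card K = p ^ n) : CharP K p := by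
  have := Fintype.ofFinite K
  obtain ⟨c, hc⟩ := CharP.exists K
  obtain ⟨m, hcp, hm⟩ := FiniteField.card K c
  rw [← Nat.card_eq_fintype_card, hK] at hm
  have : c ∣ p := hcp.dvd_of_dvd_pow (n := n) (hm ▸ dvd_pow_self c m.ne_zero)
  rwa [(Nat.prime_dvd_prime_iff_eq hcp hp).1 this] at hc

theorem IsQuadratic.of_prime_pow {K : Type*} [Field K] [Finite K] {p a q : ℕ} (hp : p.Prime)
    (ha : 1 ≤ a) (hq : q = p ^ a) (hK : Nat.card K = q ^ 2) : IsQuadratic K q := by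
  have hc : CharP K p := charP_of_card hp (n := a * 2) (by rw [hK, hq, pow_mul])
  have := Fact.mk hp
  refine ⟨?_, hK, fun y z => ?_, fun y => ?_⟩
  · rw [hq]; exact hp.two_le.trans (Nat.le_self_pow (by omega) p)
  · rw [hq]; exact add_pow_char_pow y z p a
  · have := Fintype.ofFinite K
    rw [← pow_mul, ← sq, ← hK, Nat.card_eq_fintype_card, FiniteField.pow_card]

namespace IsQuadratic

variable {K : Type*} [Field K] {q : ℕ} (h : IsQuadratic K q)
include h

/-- The involution `y ↦ y ^ q` as a ring homomorphism. -/
def conj : K →+* K where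
  toFun y := y ^ q
  map_one' := one_pow q
  map_mul' y z := mul_pow y z q
  map_zero' := zero_pow (by have := h.two_le; omega)
  map_add' := h.add_pow

theorem conj_apply (y : K) : h.conj y = y ^ q := rfl

theorem neg_pow (y : K) : (-y) ^ q = -y ^ q := map_neg h.conj y

theorem sub_pow (y z : K) : (y - z) ^ q = y ^ q - z ^ q := map_sub h.conj y z

theorem zero_pow : (0 : K) ^ q = 0 := map_zero h.conj

theorem finite : Finite K := Nat.finite_of_card_ne_zero (by
  rw [h.card]; have := h.two_le; positivity)

theorem card_units : Nat.card Kˣ = q ^ 2 - 1 := by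
  rw [Nat.card_units, h.card]

omit h in
theorem ncard_pow_eq_mul_le (hq : 2 ≤ q) (c : K) : {y : K | y ^ q = c * y}.ncard ≤ q := by
  classical
  set P : Polynomial K := Polynomial.X ^ q - Polynomial.C c * Polynomial.X
  have hd : P.natDegree = q := by
    have : (Polynomial.C c * Polynomial.X : Polynomial K).natDegree < q :=
      lt_of_le_of_lt ((Polynomial.natDegree_C_mul_le _ _).trans Polynomial.natDegree_X_le) (by omega)
    rw [Polynomial.natDegree_sub_eq_left_of_natDegree_lt] <;> simp [this]
  have h0 : P ≠ 0 := by
    intro h; rw [h] at hd; simp at hd; omega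
  have : {y : K | y ^ q = c * y} ⊆ (P.roots.toFinset : Set K) := by
    intro y hy
    simp only [Set.mem_ofPred_eq] at hy
    simp [P, hy, h0]
  refine (Set.ncard_le_ncard this (Finset.finite_toSet _)).trans ?_
  rw [Set.ncard_coe_finset]
  exact (Multiset.toFinset_card_le _).trans ((Polynomial.card_roots' P).trans hd.le)

theorem exists_trace_one : ∃ z : K, z + z ^ q = 1 := by
  have := h.finite
  obtain ⟨w, hw⟩ : ∃ w : K, w + w ^ q ≠ 0 := by
    by_contra! hc
    have h1 := ncard_pow_eq_mul_le h.two_le (-1 : K)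
    have h2 : {y : K | y ^ q = -1 * y} = Set.univ := by
      ext y; simpa using (eq_neg_of_add_eq_zero_right (hc y))
    rw [h2, Set.ncard_univ, h.card] at h1
    have := h.two_le
    nlinarith
  refine ⟨w / (w + w ^ q), ?_⟩
  rw [div_pow, h.add_pow, h.pow_pow, add_comm (w ^ q) w, ← add_div, div_self hw]

/-- Additive Hilbert 90: multiplication by an element of trace one inverts y ↦ y^q - y up to sign.
-/
theorem exists_sub_of_trace_zero {t : K} (ht : t + t ^ q = 0) : ∃ y : K, y ^ q - y = t := by
  obtain ⟨z, hz⟩ := h.exists_trace_one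
  refine ⟨-(z * t), ?_⟩
  have h1 : t ^ q = -t := eq_neg_of_add_eq_zero_right ht
  rw [h.neg_pow, mul_pow, h1]
  linear_combination t * hz

/-- The two sets are the kernel and the image of y ↦ y^q - y, so their sizes multiply to q^2; each
consists of roots of a polynomial of degree q, so neither size exceeds q. -/
theorem ncard_fixed_and_trace_zero :
    {y : K | y ^ q = y}.ncard = q ∧ {b : K | b + b ^ q = 0}.ncard = q := by
  have := h.finite
  let ψ : K →+ K := h.conj.toAddMonoidHom - AddMonoidHom.id K
  have hψ : ∀ y, ψ y = y ^ q - y := fun y => rfl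
  have h1 : Nat.card ψ.range * Nat.card ψ.ker = q ^ 2 := by
    rw [← h.card, ← AddSubgroup.index_ker, mul_comm, AddSubgroup.card_mul_index]
  have hk : {y : K | y ^ q = y} = (ψ.ker : Set K) := by
    ext y; simp [AddMonoidHom.mem_ker, hψ, sub_eq_zero]
  have hr : {b : K | b + b ^ q = 0} = (ψ.range : Set K) := by
    ext b
    constructor
    · intro hb
      obtain ⟨y, hy⟩ := h.exists_sub_of_trace_zero hb
      exact ⟨y, hy⟩
    · rintro ⟨y, rfl⟩
      rw [Set.mem_ofPred_eq, hψ, h.sub_pow, h.pow_pow]; ring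
  have a1 := ncard_pow_eq_mul_le h.two_le (1 : K)
  have a2 := ncard_pow_eq_mul_le h.two_le (-1 : K)
  simp only [one_mul, neg_mul] at a1 a2
  have e2 : {y : K | y ^ q = -y} = {b : K | b + b ^ q = 0} := by
    ext y
    simp only [Set.mem_ofPred_eq]
    exact ⟨fun h => by simp [h], fun h => eq_neg_of_add_eq_zero_right h⟩
  rw [e2] at a2
  rw [hk] at a1 ⊢
  rw [hr] at a2 ⊢
  have b1 : (ψ.ker : Set K).ncard = Nat.card ψ.ker := rfl
  have b2 : (ψ.range : Set K).ncard = Nat.card ψ.range := rfl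
  rw [b1] at a1 ⊢
  rw [b2] at a2 ⊢
  have := h.two_le
  constructor <;> nlinarith

theorem exists_norm_eq {y : Kˣ} (hy : (y : K) ^ q = y) : ∃ c : Kˣ, c ^ (q + 1) = y := by
  have := h.finite
  obtain ⟨ω, hω⟩ := IsCyclic.exists_generator (α := Kˣ)
  obtain ⟨n, hn⟩ := (mem_powers_iff_mem_zpowers).2 (hω y)
  simp only at hn
  have ho : orderOf ω = q ^ 2 - 1 := by
    rw [← h.card_units, orderOf_eq_card_of_forall_mem_zpowers hω]
  have hq := h.two_le
  have hy' : y ^ (q - 1) = 1 := by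
    have : y ^ (q - 1) * y = y := by
      rw [← pow_succ, Nat.sub_add_cancel (by omega)]; ext; simpa using hy
    exact mul_eq_right.1 this
  rw [← hn, ← pow_mul] at hy'
  have h1 := orderOf_dvd_of_pow_eq_one hy'
  rw [ho, show q ^ 2 - 1 = (q + 1) * (q - 1) by
    have := Nat.sq_sub_sq q 1; simpa using this] at h1
  obtain ⟨m, rfl⟩ := Nat.dvd_of_mul_dvd_mul_right (by omega) h1
  exact ⟨ω ^ m, by rw [← pow_mul, mul_comm, hn]⟩

/-- The subfield of order `q`. -/
def fixed : Subfield K := h.conj.eqLocusField (RingHom.id K)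

theorem mem_fixed {y : K} : y ∈ h.fixed ↔ y ^ q = y := Iff.rfl

theorem card_fixed : Nat.card h.fixed = q := h.ncard_fixed_and_trace_zero.1

end IsQuadratic

/-! ### Subrings containing all r-th powers, and the exceptional parameters -/

/-- A subring of a finite field is a subfield, so a proper one has at most √|F| elements. It must
still hold the nonzero r-th powers, of which there are at least (|F| - 1)/r. -/
theorem subring_eq_top_of_pow_mem {F : Type*} [Field F] [Finite F] {r : ℕ} (hr : 0 < r)
    (A : Subring F) (hA : ∀ y : F, y ^ r ∈ A) : A = ⊤ ∨ Nat.card F < r ^ 2 := by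
  by_contra! hc
  obtain ⟨hne, hcard⟩ := hc
  have := Fintype.ofFinite F
  have hinv : ∀ y ∈ A, y⁻¹ ∈ A := by
    intro y hy
    by_cases h0 : y = 0
    · simp [h0, A.zero_mem]
    · have h1 := FiniteField.pow_card_sub_one_eq_one y h0
      have h2 := Fintype.one_lt_card (α := F)
      have : y⁻¹ = y ^ (Fintype.card F - 2) := by
        refine (eq_inv_of_mul_eq_one_left ?_).symm
        rw [← pow_succ, ← h1]; congr 1; omega
      rw [this]; exact A.pow_mem hy _
  obtain ⟨y, hy⟩ : ∃ y, y ∉ A := by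
    by_contra! h; exact hne (Subring.ext fun y => by simp [h])
  have hk2 : Nat.card A * Nat.card A ≤ Nat.card F := by
    rw [← Nat.card_prod]
    refine Nat.card_le_card_of_injective (fun ab : A × A => (ab.1 : F) + ab.2 * y) ?_
    rintro ⟨a, b⟩ ⟨a', b'⟩ hab
    simp only at hab
    by_cases hb : b = b'
    · subst hb; simpa using hab
    · exfalso
      have hb' : (b : F) - b' ≠ 0 := sub_ne_zero.2 fun h => hb (Subtype.ext h)
      apply hy
      have : y = (a' - a) * ((b : F) - b')⁻¹ := by
        rw [eq_mul_inv_iff_mul_eq₀ hb']; linear_combination hab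
      rw [this]
      exact A.mul_mem (A.sub_mem a'.2 a.2) (hinv _ (A.sub_mem b.2 b'.2))
  have hU : Nat.card (powMonoidHom r : Fˣ →* Fˣ).range + 1 ≤ Nat.card A := by
    have h1 : Nat.card (Option (powMonoidHom r : Fˣ →* Fˣ).range) ≤ Nat.card A := by
      refine Nat.card_le_card_of_injective (fun o => o.elim (0 : A) fun u => ⟨((u : Fˣ) : F), ?_⟩) ?_
      · obtain ⟨w, hw⟩ := u.2
        rw [← hw]; simpa using hA w
      · rintro (_ | u) (_ | w) huw
        · rfl
        · simp [Subtype.ext_iff] at huw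
          exact absurd huw.symm w.1.ne_zero
        · simp [Subtype.ext_iff] at huw
        · simp [Subtype.ext_iff] at huw
          congr; exact Subtype.ext (Units.ext huw)
    simpa using h1
  have hker : Nat.card (powMonoidHom r : Fˣ →* Fˣ).ker ≤ r := by
    have : NeZero r := ⟨hr.ne'⟩
    have h1 : (powMonoidHom r : Fˣ →* Fˣ).ker = rootsOfUnity r F := by
      ext u; simp [MonoidHom.mem_ker, mem_rootsOfUnity]
    rw [h1]; exact card_rootsOfUnity F r
  have h3 := (powMonoidHom r : Fˣ →* Fˣ).ker.card_mul_index
  rw [Subgroup.index_ker, mul_comm] at h3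
  rw [Nat.card_units] at h3
  -- With |F| = N + 1 and |A| = k + 1 the bounds read k^2 + 2k ≤ N ≤ kr, so k + 2 ≤ r and N ≤ r(r -
  -- 2).
  have hF : 1 ≤ Nat.card F := Nat.card_pos
  obtain ⟨N, hN⟩ : ∃ N, Nat.card F = N + 1 := ⟨_, (Nat.sub_add_cancel hF).symm⟩
  obtain ⟨k, hk⟩ : ∃ k, Nat.card A = k + 1 := ⟨_, (Nat.sub_add_cancel Nat.card_pos).symm⟩
  rw [hN] at hk2 hcard h3
  rw [hk] at hU hk2
  simp only [Nat.add_sub_cancel] at h3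
  have h4 : N ≤ k * r := h3 ▸ Nat.mul_le_mul (by omega) hker
  have hkp : 0 < k := by
    rcases Nat.eq_zero_or_pos k with h0 | h0
    · subst h0
      have : N + 1 ≤ 1 := by omega
      have h5 := Finite.one_lt_card (α := F) |>.trans_le (hN ▸ this)
      omega
    · exact h0
  have h5 : k + 2 ≤ r := by
    by_contra! h; nlinarith
  nlinarith

/-- The hypotheses give 2^(r-1) ≤ p^a < r^2, which fails for r ≥ 7; the cases r = 3 and r = 5 then
determine p and a. -/
theorem exceptional_parameters {p a r : ℕ} (hp : p.Prime) (ha : 1 ≤ a) (hr : r.Prime) (hr2 : r ≠ 2)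
    (hra : r - 1 ∣ a) (hlt : p ^ a < r ^ 2) :
    (p = 2 ∧ a = 2 ∧ r = 3) ∨ (p = 2 ∧ a = 4 ∧ r = 5) := by
  have hr' := hr.two_le
  have hle := Nat.le_of_dvd ha hra
  have h2 : 2 ^ (r - 1) < r ^ 2 :=
    lt_of_le_of_lt ((Nat.pow_le_pow_right (by norm_num) hle).trans
      (Nat.pow_le_pow_left hp.two_le a)) hlt
  have hr7 : r < 7 := by
    by_contra! hc
    have key : ∀ n, 7 ≤ n → n ^ 2 ≤ 2 ^ (n - 1) := by
      intro n hn
      induction n, hn using Nat.le_induction with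
      | base => norm_num
      | succ n hn ih =>
        obtain ⟨m, rfl⟩ : ∃ m, n = m + 1 := ⟨n - 1, by omega⟩
        simp only [Nat.add_sub_cancel] at ih ⊢
        rw [pow_succ 2 m]; nlinarith
    exact absurd (key r hc) (by omega)
  have hp2 := hp.two_le
  interval_cases r
  · exact absurd rfl hr2
  · left
    obtain ⟨b, rfl⟩ := hra
    have hb : b = 1 := by
      by_contra hb
      have := (Nat.pow_le_pow_right (n := 2) (by norm_num) (show 4 ≤ 2 * b by omega)).trans
        (Nat.pow_le_pow_left hp2 (2 * b))
      norm_num at hlt this ⊢; omega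
    subst hb
    refine ⟨?_, rfl, rfl⟩
    norm_num at hlt; nlinarith
  · exact absurd hr (by norm_num)
  · right
    obtain ⟨b, rfl⟩ := hra
    have hb : b = 1 := by
      by_contra hb
      have := (Nat.pow_le_pow_right (n := 2) (by norm_num) (show 8 ≤ 4 * b by omega)).trans
        (Nat.pow_le_pow_left hp2 (4 * b))
      norm_num at hlt this ⊢; omega
    subst hb
    refine ⟨?_, rfl, rfl⟩
    by_contra hne
    have := Nat.pow_le_pow_left (show 3 ≤ p by omega) 4
    norm_num at hlt this; omega
  · exact absurd hr (by norm_num)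

/-! ### Blocks in affine coordinates -/

/-- The conditions that `IsBlock` imposes on the set of points `⟨ω ^ r⟩ κ (f + s x + t e)` of a
block containing `⟨ω ^ r⟩ f`: the point with coordinates `κ, s, t` belongs to the block
if and only if `D κ s t`. -/
structure AffineBlock {K : Type*} [Field K] (q r : ℕ) (D : Kˣ → K → K → Prop) : Prop where
  iso : ∀ {κ s t}, D κ s t → s ^ (q + 1) + t + t ^ q = 0
  base : D 1 0 0
  mul_pow : ∀ {κ s t}, D κ s t → ∀ y : Kˣ, D (κ * y ^ r) s t
  move : ∀ (c : Kˣ) (s t : K), s ^ (q + 1) + t + t ^ q = 0 → ∀ {κ₁ s₁ t₁}, D κ₁ s₁ t₁ →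
    D ((c ^ (q + 1))⁻¹ * κ₁) (s + c ^ (2 * q - 1) * s₁)
      (t + c ^ (q + 1) * t₁ - c ^ (2 * q - 1) * s₁ * s ^ q) → ∀ {κ₂ s₂ t₂}, D κ₂ s₂ t₂ →
    D ((c ^ (q + 1))⁻¹ * κ₂) (s + c ^ (2 * q - 1) * s₂)
      (t + c ^ (q + 1) * t₂ - c ^ (2 * q - 1) * s₂ * s ^ q)

/-- The arithmetic conditions on `q` and `r` that follow from the rank of the group. -/
structure Admissible (q r : ℕ) : Prop where
  prime : r.Prime
  dvd : r ∣ q - 1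
  not_dvd : ¬ r ∣ q + 1
  coprime : (q ^ 2 - 1).Coprime (2 * q - 1)

namespace AffineBlock

variable {K : Type*} [Field K] {q r : ℕ} {D : Kˣ → K → K → Prop}
  (hD : AffineBlock q r D) (hK : IsQuadratic K q) (hqr : Admissible q r)

section
include hD hK

-- A point with κ = 1 is the image of f under a unipotent element, which therefore preserves the
-- block.
omit hK in
theorem compose_one {s t : K} (h1 : D 1 s t) {κ : Kˣ} {s' t' : K} (h2 : D κ s' t') :
    D κ (s + s') (t + t' - s' * s ^ q) := by
  have := hD.move 1 s t (hD.iso h1) hD.base (by simpa using h1) h2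
  simpa using this

/-- Two points over the same scalar differ by a unipotent element, and this element preserves the
block over every other scalar as well. -/
theorem translate {κ : Kˣ} {s t s' t' : K} (h1 : D κ s t) (h2 : D κ s' t') {κ' : Kˣ} {a b : K}
    (h3 : D κ' a b) :
    D κ' (s' - s + a) (t' - t + s * (s' - s) ^ q + b - a * (s' - s) ^ q) := by
  have i1 := hD.iso h1
  have i2 := hD.iso h2
  have := hD.move 1 (s' - s) (t' - t + s * (s' - s) ^ q) ?_ h1 (by
    convert h2 using 1
    · simp
    · simp
    · simp; ring) h3
  · simpa using this
  · simp only [pow_succ, hK.sub_pow, hK.add_pow, _root_.mul_pow, hK.pow_pow] at i1 i2 ⊢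
    linear_combination i2 - i1

/-- The torus element with parameter y^r multiplies scalars by an r-th power. It thus fixes the
point of f and preserves the block, and the change of κ can be undone. -/
theorem scale {κ : Kˣ} {s t : K} (h1 : D κ s t) (y : Kˣ) :
    D κ ((y ^ r : Kˣ) ^ (2 * q - 1) * s) ((y ^ r : Kˣ) ^ (q + 1) * t) := by
  have h0 : D 1 0 0 := hD.base
  have h2 := hD.move (y ^ r) 0 0 (by simp [hK.zero_pow]) h0 (by
    have := hD.mul_pow h0 ((y⁻¹) ^ (q + 1))
    simpa [← pow_mul, mul_comm] using this) h1
  have h3 := hD.mul_pow h2 (y ^ (q + 1))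
  have e : ((y ^ r) ^ (q + 1))⁻¹ * κ * (y ^ (q + 1)) ^ r = κ := by
    rw [← pow_mul, ← pow_mul, mul_comm (q + 1) r, mul_right_comm, inv_mul_cancel, one_mul]
  rw [e] at h3
  simpa [hK.zero_pow] using h3

-- The version of `compose_one` with a torus part; by `exists_norm_mul_pow` the shape required of
-- the first scalar is no restriction.
omit hK in
theorem compose {c y : Kˣ} {s t : K} (h1 : D ((c ^ (q + 1))⁻¹ * y ^ r) s t) {κ : Kˣ} {s' t' : K}
    (h2 : D κ s' t') : D ((c ^ (q + 1))⁻¹ * κ) (s + c ^ (2 * q - 1) * s')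
      (t + c ^ (q + 1) * t' - c ^ (2 * q - 1) * s' * s ^ q) := by
  refine hD.move c s t (hD.iso h1) hD.base ?_ h2
  have := hD.mul_pow h1 y⁻¹
  simpa using this

omit hK in
theorem pow_mem_iff (y : Kˣ) (s t : K) : D (y ^ r) s t ↔ D 1 s t := by
  refine ⟨fun h => ?_, fun h => ?_⟩
  · simpa using hD.mul_pow h y⁻¹
  · simpa using hD.mul_pow h y

end

section
include hqr

theorem exists_norm_mul_pow (κ : Kˣ) : ∃ c y : Kˣ, κ = (c ^ (q + 1))⁻¹ * y ^ r := by
  have hc : IsCoprime (r : ℤ) ((q + 1 : ℕ) : ℤ) :=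
    Nat.isCoprime_iff_coprime.2 ((Nat.Prime.coprime_iff_not_dvd hqr.prime).2 hqr.not_dvd)
  obtain ⟨u, v, huv⟩ := hc
  refine ⟨κ ^ (-v), κ ^ u, ?_⟩
  rw [← zpow_natCast, ← zpow_natCast, ← zpow_mul, ← zpow_mul, ← zpow_neg, ← zpow_add]
  rw [show -(-v * ((q + 1 : ℕ) : ℤ)) + u * (r : ℤ) = 1 by linarith, zpow_one]

include hK

theorem lt_of_admissible : r + 1 ≤ q := by
  have := hK.two_le
  have := Nat.le_of_dvd (by omega) hqr.dvd
  omega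

omit hqr in
theorem exists_generator : ∃ ω : Kˣ, orderOf ω = q ^ 2 - 1 ∧ ∀ y, y ∈ Subgroup.zpowers ω := by
  have := hK.finite
  obtain ⟨ω, hω⟩ := IsCyclic.exists_generator (α := Kˣ)
  exact ⟨ω, by rw [← hK.card_units, orderOf_eq_card_of_forall_mem_zpowers hω], hω⟩

/-- The r-th powers have prime index r, so every nontrivial class generates the quotient. -/
theorem exists_pow_mul_pow (κ : Kˣ) (hκ : ¬ ∃ y : Kˣ, κ = y ^ r) (κ' : Kˣ) :
    ∃ (n : ℕ) (y : Kˣ), κ' = κ ^ n * y ^ r := by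
  have := hK.finite
  have hq := hK.two_le
  have hdvd : r ∣ Nat.card Kˣ := by
    rw [hK.card_units, show q ^ 2 - 1 = (q + 1) * (q - 1) by
      have := Nat.sq_sub_sq q 1; simpa using this]
    exact hqr.dvd.mul_left _
  set N := (powMonoidHom r : Kˣ →* Kˣ).range
  have hN : Nat.card (Kˣ ⧸ N) = r := by
    rw [← Subgroup.index_eq_card, IsCyclic.index_powMonoidHom_range]
    exact Nat.gcd_eq_right hdvd
  have := Fact.mk hqr.prime
  have h1 : (QuotientGroup.mk κ : Kˣ ⧸ N) ≠ 1 := by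
    rw [Ne, QuotientGroup.eq_one_iff]
    rintro ⟨y, hy⟩
    exact hκ ⟨y, hy.symm⟩
  obtain ⟨n, hn⟩ := mem_powers_of_prime_card hN h1 (g' := (QuotientGroup.mk κ' : Kˣ ⧸ N))
  simp only [← QuotientGroup.mk_pow] at hn
  obtain ⟨y, hy⟩ := QuotientGroup.eq.1 hn
  refine ⟨n, y, ?_⟩
  rw [show y ^ r = (κ ^ n)⁻¹ * κ' from hy, mul_inv_cancel_left]

include hD

/-- The multipliers preserving the set of s-components form a subring of K that contains all r-th
powers, hence equal K because r < q. So every s occurs, and commutators then supply every t of trace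
zero. -/
theorem all_of_exists {s₀ t₀ : K} (h0 : D 1 s₀ t₀) (hs : s₀ ≠ 0) {s t : K}
    (hst : s ^ (q + 1) + t + t ^ q = 0) : D 1 s t := by
  have := hK.finite
  have hlt := lt_of_admissible hK hqr
  let A : Subring K :=
    { carrier := {y | ∀ s, (∃ t, D 1 s t) → ∃ t, D 1 (y * s) t}
      mul_mem' := fun {a b} ha hb s hs => by rw [mul_assoc]; exact ha _ (hb s hs)
      one_mem' := fun s hs => by simpa using hs
      add_mem' := fun {a b} ha hb s hs => by
        obtain ⟨t, ht⟩ := ha s hs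
        obtain ⟨t', ht'⟩ := hb s hs
        rw [add_mul]
        exact ⟨_, hD.compose_one ht ht'⟩
      zero_mem' := fun s hs => ⟨0, by simpa using hD.base⟩
      neg_mem' := fun {a} ha s hs => by
        obtain ⟨t, ht⟩ := ha s hs
        have := hD.translate hK ht hD.base hD.base
        exact ⟨_, by simpa using this⟩ }
  have hA : ∀ y : K, y ^ r ∈ A := by
    intro y s hs
    by_cases hy : y = 0
    · subst hy
      rw [zero_pow hqr.prime.ne_zero, zero_mul]; exact ⟨0, hD.base⟩
    · obtain ⟨c, hc⟩ := (powCoprime (G := Kˣ) (n := 2 * q - 1)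
        (by rw [hK.card_units]; exact hqr.coprime)).surjective (Units.mk0 y hy)
      obtain ⟨t, ht⟩ := hs
      have := hD.scale hK ht c
      refine ⟨((c ^ r : Kˣ) : K) ^ (q + 1) * t, ?_⟩
      · convert this using 2
        have : y = (c : K) ^ (2 * q - 1) := by
          rw [← Units.val_pow_eq_pow_val]; exact (congrArg Units.val hc).symm
        rw [this, Units.val_pow_eq_pow_val, ← pow_mul, ← pow_mul, mul_comm r]
  have htop : A = ⊤ := by
    refine (subring_eq_top_of_pow_mem hqr.prime.pos A hA).resolve_right ?_
    rw [hK.card]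
    have := Nat.pow_le_pow_left (show r ≤ q by omega) 2
    omega
  have hall : ∀ s, ∃ t, D 1 s t := by
    intro s
    have : s / s₀ ∈ A := htop ▸ Subring.mem_top _
    have := this s₀ ⟨t₀, h0⟩
    rwa [div_mul_cancel₀ _ hs] at this
  have hW : ∀ t, t + t ^ q = 0 → D 1 0 t := by
    intro t ht
    -- Points over s = 1 and s = y, composed in both orders, share the same s; their t-components
    -- differ by ±(y^q - y).
    obtain ⟨y, rfl⟩ := hK.exists_sub_of_trace_zero ht
    obtain ⟨t1, h1⟩ := hall 1
    obtain ⟨t2, h2⟩ := hall y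
    have a1 := hD.compose_one h1 h2
    have a2 := hD.compose_one h2 h1
    rw [add_comm] at a2
    have := hD.translate hK a1 a2 hD.base
    have h3 := hD.translate hK this hD.base hD.base
    convert h3 using 1
    · simp
    · simp [hK.zero_pow]; ring
  obtain ⟨t', ht'⟩ := hall s
  have i := hD.iso ht'
  have := hD.compose_one (hW (t - t') (by
    rw [hK.sub_pow]; linear_combination hst - i)) ht'
  simpa [hK.zero_pow] using this

/-- Comparing a point with its scaling by ω gives (ω^(r(2q-1)) - 1)s over κ = 1. If this vanished
with s ≠ 0, then q^2 - 1 would divide r, as 2q - 1 is prime to it. -/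
theorem fst_eq_zero (h0 : ∀ s t, D 1 s t → s = 0) {κ : Kˣ} {s t : K} (h : D κ s t) : s = 0 := by
  obtain ⟨ω, ho, -⟩ := exists_generator hK
  have h1 := h0 _ _ (hD.translate hK h (hD.scale hK h ω) hD.base)
  rw [add_zero, sub_eq_zero] at h1
  by_contra hs
  have h2 : ω ^ (r * (2 * q - 1)) = 1 := by
    rw [pow_mul]; ext
    simpa using mul_eq_right₀ hs |>.1 h1
  have h3 := orderOf_dvd_of_pow_eq_one h2
  rw [ho] at h3
  have h4 := Nat.le_of_dvd hqr.prime.pos (hqr.coprime.dvd_of_dvd_mul_right h3)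
  have := lt_of_admissible hK hqr
  have := hqr.prime.two_le
  have : q ^ 2 ≤ r + 1 := by omega
  nlinarith

/-- Composition multiplies scalars, and the powers of κ₀ meet every class modulo r-th powers. -/
theorem exists_of_not_pow {κ₀ : Kˣ} {s₀ t₀ : K} (h0 : D κ₀ s₀ t₀)
    (hκ₀ : ¬ ∃ y : Kˣ, κ₀ = y ^ r) (κ : Kˣ) : ∃ s t, D κ s t := by
  obtain ⟨n, y, rfl⟩ := exists_pow_mul_pow hK hqr κ₀ hκ₀ κ
  suffices ∃ s t, D (κ₀ ^ n) s t by
    obtain ⟨s, t, h⟩ := this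
    exact ⟨s, t, hD.mul_pow h y⟩
  obtain ⟨c, z, hcz⟩ := exists_norm_mul_pow hqr κ₀
  induction n with
  | zero => exact ⟨0, 0, by simpa using hD.base⟩
  | succ n ih =>
    obtain ⟨s, t, h⟩ := ih
    have h1 : D ((c ^ (q + 1))⁻¹ * z ^ r) s₀ t₀ := hcz ▸ h0
    have h2 := hD.mul_pow (hD.compose h1 h) z
    rw [mul_right_comm, ← hcz, ← pow_succ'] at h2
    exact ⟨_, _, h2⟩

omit hqr in
/-- When all scalars occur, the elements of the block over `f` are invariant under norms. -/
theorem norm_mul (hall : ∀ κ, ∃ t, D κ 0 t) {t : K}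
    (h : D 1 0 t) (c : Kˣ) : D 1 0 (c ^ (q + 1) * t) := by
  -- Composition produces u + c^(q+1)t over the scalar of u; translating back removes u.
  obtain ⟨u, hu⟩ := hall ((c ^ (q + 1))⁻¹)
  have h1 := hD.compose (c := c) (y := 1) (by simpa using hu) h
  have := hD.translate hK hu (by simpa using h1) hD.base
  simpa [hK.zero_pow] using this

/-- The subring argument over 𝔽_q: every nonzero element of 𝔽_q is a norm c^(q+1), so its r-th power
acts by scaling. The trace-zero elements form a line over 𝔽_q, so one nonzero t yields all of them.
-/
theorem mem_of_trace_zero_or_lt {t₀ : K} (ht₀ : t₀ ≠ 0) (h0 : D 1 0 t₀) :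
    (∀ t, t + t ^ q = 0 → D 1 0 t) ∨ q < r ^ 2 := by
  have := hK.finite
  have hlt := lt_of_admissible hK hqr
  let A : Subring hK.fixed :=
    { carrier := {y | ∀ t, D 1 0 t → D 1 0 (y * t)}
      mul_mem' := fun {a b} ha hb t ht => by
        rw [Subfield.coe_mul, mul_assoc]; exact ha _ (hb t ht)
      one_mem' := fun s hs => by simpa using hs
      add_mem' := fun {a b} ha hb t ht => by
        have := hD.compose_one (ha t ht) (hb t ht)
        simpa [add_mul, hK.zero_pow] using this
      zero_mem' := fun s hs => by simpa using hD.base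
      neg_mem' := fun {a} ha t ht => by
        have := hD.translate hK (ha t ht) hD.base hD.base
        simpa [hK.zero_pow] using this }
  have hA : ∀ y : hK.fixed, y ^ r ∈ A := by
    intro y t ht
    by_cases hy : y = 0
    · subst hy
      rw [zero_pow hqr.prime.ne_zero]; simpa using hD.base
    · obtain ⟨c, hc⟩ := hK.exists_norm_eq (y := Units.mk0 (y : K) (by simpa using hy))
        (hK.mem_fixed.1 y.2)
      have hc' : (c : K) ^ (q + 1) = y := by
        rw [← Units.val_pow_eq_pow_val, hc]; rfl
      have := hD.scale hK ht c
      rw [mul_zero, Units.val_pow_eq_pow_val, ← pow_mul, mul_comm r, pow_mul, hc'] at this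
      rw [SubmonoidClass.coe_pow]
      convert this using 1
  refine (subring_eq_top_of_pow_mem hqr.prime.pos A hA).imp (fun htop t ht => ?_) fun h => ?_
  · have i := hD.iso h0
    rw [_root_.zero_pow (by omega), zero_add] at i
    have hf : (t / t₀) ^ q = t / t₀ := by
      rw [div_pow, eq_neg_of_add_eq_zero_right ht, eq_neg_of_add_eq_zero_right i, neg_div_neg_eq]
    have : (⟨t / t₀, hK.mem_fixed.2 hf⟩ : hK.fixed) ∈ A := htop ▸ Subring.mem_top _
    have := this t₀ h0
    simpa [div_mul_cancel₀ _ ht₀] using this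
  · rwa [hK.card_fixed] at h

/-- The first four outcomes describe B₁, B₂, B₃ and B₄. The fifth is a proper nonzero part of B₂;
the sixth has exactly one point over each scalar class, as B₃ does. -/
theorem classification (hne : ∃ κ s t, D κ s t ∧ ¬ ((∃ y : Kˣ, κ = y ^ r) ∧ s = 0 ∧ t = 0))
    (hproper : ∃ (κ : Kˣ) (s t : K), s ^ (q + 1) + t + t ^ q = 0 ∧ ¬ D κ s t) :
    (∀ κ s t, D κ s t ↔ (∃ y : Kˣ, κ = y ^ r) ∧ s ^ (q + 1) + t + t ^ q = 0) ∨
    (∀ κ s t, D κ s t ↔ (∃ y : Kˣ, κ = y ^ r) ∧ s = 0 ∧ t + t ^ q = 0) ∨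
    (∀ κ s t, D κ s t ↔ s = 0 ∧ t = 0) ∨
    (∀ κ s t, D κ s t ↔ s = 0 ∧ t + t ^ q = 0) ∨
    (q < r ^ 2 ∧ (∀ κ s t, D κ s t → (∃ y : Kˣ, κ = y ^ r) ∧ s = 0) ∧
      (∃ t, t ≠ 0 ∧ D 1 0 t) ∧ ∃ t, t + t ^ q = 0 ∧ ¬ D 1 0 t) ∨
    (q = r + 1 ∧ (∀ κ, ∃ t, D κ 0 t) ∧ (∀ κ s t, D κ s t → s = 0) ∧ ∀ t, D 1 0 t → t = 0) := by
  have hq0 : q + 1 ≠ 0 := by omega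
  have iso0 : ∀ {κ t}, D κ 0 t → t + t ^ q = 0 := by
    intro κ t h
    have := hD.iso h
    rwa [_root_.zero_pow hq0, zero_add] at this
  by_cases hJ : ∃ κ₀ s₀ t₀, D κ₀ s₀ t₀ ∧ ¬ ∃ y : Kˣ, κ₀ = y ^ r
  · obtain ⟨κ₀, s₀, t₀, h0, hκ₀⟩ := hJ
    have hall := hD.exists_of_not_pow hK hqr h0 hκ₀
    by_cases hP : ∃ s t, D 1 s t ∧ s ≠ 0
    -- Every scalar and every unipotent element would be available, so D would hold at all isotropic
    -- triples.
    · exfalso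
      obtain ⟨s₁, t₁, h1, hs₁⟩ := hP
      obtain ⟨κ, s, t, hst, hn⟩ := hproper
      obtain ⟨s', t', h'⟩ := hall κ
      have i := hD.iso h'
      apply hn
      have := hD.compose_one (s := s - s') (t := t - t' + s' * (s - s') ^ q)
        (hD.all_of_exists hK hqr h1 hs₁ (by
          simp only [pow_succ, hK.sub_pow, hK.add_pow, _root_.mul_pow, hK.pow_pow] at i hst ⊢
          linear_combination hst - i)) h'
      convert this using 1
      · ring
      · ring
    · push Not at hP
      have hs : ∀ κ s t, D κ s t → s = 0 := fun κ s t h => hD.fst_eq_zero hK hqr hP h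
      have hall' : ∀ κ, ∃ t, D κ 0 t := by
        intro κ
        obtain ⟨s, t, h⟩ := hall κ
        obtain rfl := hs _ _ _ h
        exact ⟨t, h⟩
      by_cases hW : ∃ t, D 1 0 t ∧ t ≠ 0
      · obtain ⟨t₁, h1, ht₁⟩ := hW
        right; right; right; left
        have hW : ∀ t, t + t ^ q = 0 → D 1 0 t := by
          intro t ht
          by_cases h0 : t = 0
          · subst h0; exact hD.base
          have hf : (t / t₁) ^ q = t / t₁ := by
            rw [div_pow, eq_neg_of_add_eq_zero_right ht, eq_neg_of_add_eq_zero_right (iso0 h1),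
              neg_div_neg_eq]
          obtain ⟨c, hc⟩ := hK.exists_norm_eq (y := Units.mk0 _ (div_ne_zero h0 ht₁)) hf
          have hc' : (c : K) ^ (q + 1) = t / t₁ := by
            rw [← Units.val_pow_eq_pow_val, hc]; rfl
          have := hD.norm_mul hK hall' h1 c
          rwa [hc', div_mul_cancel₀ _ ht₁] at this
        intro κ s t
        refine ⟨fun h => ?_, ?_⟩
        · obtain rfl := hs _ _ _ h
          exact ⟨rfl, iso0 h⟩
        · rintro ⟨rfl, ht⟩
          obtain ⟨u, hu⟩ := hall' κ
          have := hD.compose_one (hW (t - u) (by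
            rw [hK.sub_pow]; linear_combination ht - iso0 hu)) hu
          simpa [hK.zero_pow] using this
      · push Not at hW
        by_cases hq : q = r + 1
        · right; right; right; right; right
          exact ⟨hq, hall', hs, hW⟩
        · right; right; left
          obtain ⟨ω, ho, -⟩ := exists_generator hK
          -- Each scalar carries a single t here, and scaling by ω multiplies it by ω^(r(q+1)). A
          -- nonzero t would force q - 1 to divide r, hence q = r + 1.
          have ht : ∀ κ t, D κ 0 t → t = 0 := by
            intro κ t h
            have h1 := hD.scale hK h ω
            rw [mul_zero] at h1
            have h2 := hD.translate hK h h1 hD.base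
            have h3 := hW _ (by simpa [hK.zero_pow] using h2)
            by_contra h0
            rw [sub_eq_zero] at h3
            have h4 : ω ^ (r * (q + 1)) = 1 := by
              rw [pow_mul]; ext
              simpa using mul_eq_right₀ h0 |>.1 h3
            have h5 := orderOf_dvd_of_pow_eq_one h4
            rw [ho, show q ^ 2 - 1 = (q + 1) * (q - 1) by
              have := Nat.sq_sub_sq q 1; simpa using this, mul_comm r] at h5
            have h6 := Nat.dvd_antisymm (Nat.dvd_of_mul_dvd_mul_left (by omega) h5) hqr.dvd
            have := lt_of_admissible hK hqr
            omega
          intro κ s t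
          refine ⟨fun h => ?_, ?_⟩
          · obtain rfl := hs _ _ _ h
            exact ⟨rfl, ht _ _ h⟩
          · rintro ⟨rfl, rfl⟩
            obtain ⟨t, h⟩ := hall' κ
            obtain rfl := ht _ _ h
            exact h
  · push Not at hJ
    by_cases hP : ∃ s t, D 1 s t ∧ s ≠ 0
    · left
      obtain ⟨s₁, t₁, h1, hs₁⟩ := hP
      intro κ s t
      refine ⟨fun h => ⟨hJ _ _ _ h, hD.iso h⟩, ?_⟩
      rintro ⟨⟨y, rfl⟩, h⟩
      exact (hD.pow_mem_iff y s t).2 (hD.all_of_exists hK hqr h1 hs₁ h)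
    · push Not at hP
      have hs : ∀ κ s t, D κ s t → s = 0 := fun κ s t h => hD.fst_eq_zero hK hqr hP h
      have hex : ∃ t, t ≠ 0 ∧ D 1 0 t := by
        obtain ⟨κ, s, t, h, hn⟩ := hne
        obtain rfl := hs _ _ _ h
        obtain ⟨y, rfl⟩ := hJ _ _ _ h
        exact ⟨t, fun h0 => hn ⟨⟨y, rfl⟩, rfl, h0⟩, (hD.pow_mem_iff y 0 t).1 h⟩
      obtain ⟨t₁, ht₁, h1⟩ := hex
      by_cases hW : ∀ t, t + t ^ q = 0 → D 1 0 t
      · right; left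
        intro κ s t
        refine ⟨fun h => ?_, ?_⟩
        · obtain rfl := hs _ _ _ h
          exact ⟨hJ _ _ _ h, rfl, iso0 h⟩
        · rintro ⟨⟨y, rfl⟩, rfl, h⟩
          exact (hD.pow_mem_iff y 0 t).2 (hW t h)
      · right; right; right; right; left
        refine ⟨(hD.mem_of_trace_zero_or_lt hK hqr ht₁ h1).resolve_left hW,
          fun κ s t h => ⟨hJ _ _ _ h, hs _ _ _ h⟩, ⟨t₁, ht₁, h1⟩, ?_⟩
        push Not at hW
        exact hW

end

end AffineBlock

/-! ### Points -/

section Points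

variable {K : Type*} [Field K] {q r : ℕ} {ω : Kˣ} (hω : Subgroup.zpowers ω = ⊤)

include hω in
theorem mem_zpowers_pow_iff {μ : Kˣ} : μ ∈ Subgroup.zpowers (ω ^ r) ↔ ∃ y : Kˣ, μ = y ^ r := by
  constructor
  · rintro ⟨n, rfl⟩
    exact ⟨ω ^ n, by simp only [← zpow_natCast, ← zpow_mul, mul_comm]⟩
  · rintro ⟨y, rfl⟩
    obtain ⟨n, rfl⟩ : y ∈ Subgroup.zpowers ω := hω ▸ Subgroup.mem_top y
    exact ⟨n, by simp only [← zpow_natCast, ← zpow_mul, mul_comm]⟩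

include hω in
theorem mem_pt {v w : V K} : w ∈ pt ω r v ↔ ∃ y : Kˣ, w = y ^ r • v := by
  constructor
  · rintro ⟨μ, hμ, rfl⟩
    obtain ⟨y, rfl⟩ := (mem_zpowers_pow_iff hω).1 hμ
    exact ⟨y, rfl⟩
  · rintro ⟨y, rfl⟩
    exact ⟨y ^ r, (mem_zpowers_pow_iff hω).2 ⟨y, rfl⟩, rfl⟩

include hω in
theorem pt_eq_iff {v w : V K} : pt ω r v = pt ω r w ↔ ∃ y : Kˣ, v = y ^ r • w := by
  constructor
  · intro h
    rw [← mem_pt hω, ← h, mem_pt hω]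
    exact ⟨1, by simp⟩
  · rintro ⟨y, rfl⟩
    ext u
    rw [mem_pt hω, mem_pt hω]
    constructor
    · rintro ⟨z, rfl⟩
      exact ⟨z * y, by rw [mul_pow, mul_smul]⟩
    · rintro ⟨z, rfl⟩
      exact ⟨z * y⁻¹, by rw [← mul_smul, ← mul_pow, inv_mul_cancel_right]⟩

include hω in
theorem pt_pow_smul (y : Kˣ) (v : V K) : pt ω r (y ^ r • v) = pt ω r v :=
  (pt_eq_iff hω).2 ⟨y, rfl⟩

include hω in
theorem mem_cell (hr : 0 < r) {v : V K} {S : Set (V K)} :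
    S ∈ cell ω r v ↔ ∃ κ : Kˣ, S = pt ω r (κ • v) := by
  constructor
  · rintro ⟨i, -, rfl⟩
    exact ⟨_, rfl⟩
  · rintro ⟨κ, rfl⟩
    obtain ⟨n, rfl⟩ : κ ∈ Subgroup.zpowers ω := hω ▸ Subgroup.mem_top κ
    simp only
    have h0 : (0 : ℤ) ≤ n % r := Int.emod_nonneg _ (by omega)
    have h1 : n % r < r := Int.emod_lt_of_pos _ (by omega)
    refine ⟨(n % r).toNat, by omega, (pt_eq_iff hω).2 ⟨ω ^ (n / r), ?_⟩⟩
    rw [← mul_smul, ← zpow_natCast, ← zpow_natCast, ← zpow_mul, ← zpow_add,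
      Int.toNat_of_nonneg h0, mul_comm, add_comm, Int.emod_add_mul_ediv]

theorem form_affine (κ : Kˣ) (s t : K) :
    form q (κ • ![t, s, 1]) (κ • ![t, s, 1]) = (κ : K) ^ (q + 1) * (s ^ (q + 1) + t + t ^ q) := by
  simp [form, Units.smul_def, mul_pow, pow_succ]; ring

theorem form_smul (κ : Kˣ) (v : V K) :
    form q (κ • v) (κ • v) = (κ : K) ^ (q + 1) * form q v v := by
  simp [form, Units.smul_def, mul_pow, pow_succ]; ring

include hω in
theorem pt_mem_Omega {v : V K} : pt ω r v ∈ Omega q ω r ↔ v ≠ 0 ∧ form q v v = 0 := by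
  constructor
  · rintro ⟨w, h0, h1, h2⟩
    obtain ⟨y, rfl⟩ := (pt_eq_iff hω).1 h2
    refine ⟨fun h => h0 ?_, by rw [form_smul, h1, mul_zero]⟩
    simpa [smul_eq_zero_iff_eq] using h
  · rintro ⟨h0, h1⟩
    exact ⟨v, h0, h1, rfl⟩

theorem affine_ne_zero (κ : Kˣ) (s t : K) : κ • ![t, s, 1] ≠ (0 : V K) := fun h => by
  simpa [Units.smul_def] using congrFun h 2

include hω in
theorem affine_pt_eq_iff {κ κ' : Kˣ} {s t s' t' : K} :
    pt ω r (κ • ![t, s, 1]) = pt ω r (κ' • ![t', s', 1]) ↔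
      (∃ y : Kˣ, κ = κ' * y ^ r) ∧ s = s' ∧ t = t' := by
  rw [pt_eq_iff hω]
  constructor
  · rintro ⟨y, h⟩
    have h2 := congrFun h 2
    have h1 := congrFun h 1
    have h0 := congrFun h 0
    rw [← mul_smul] at h0 h1 h2
    simp only [Units.smul_def, Pi.smul_apply, smul_eq_mul, Matrix.cons_val, mul_one] at h0 h1 h2
    have e2 : κ = y ^ r * κ' := Units.ext h2
    rw [← e2] at h0 h1
    exact ⟨⟨y, by rw [e2, mul_comm]⟩, mul_left_cancel₀ κ.ne_zero h1, mul_left_cancel₀ κ.ne_zero h0⟩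
  · rintro ⟨⟨y, rfl⟩, rfl, rfl⟩
    exact ⟨y, by rw [← mul_smul, mul_comm]⟩

include hω in
theorem affine_not_mem_cell (hr : 0 < r) (κ : Kˣ) (s t : K) :
    pt ω r (κ • ![t, s, 1]) ∉ cell ω r (e K) := by
  rw [mem_cell hω hr]
  rintro ⟨κ', h⟩
  obtain ⟨y, h⟩ := (pt_eq_iff hω).1 h
  simpa [Units.smul_def, e] using congrFun h 2

-- An isotropic vector without f-coordinate has no x-coordinate either and is a multiple of e;
-- otherwise one divides by the f-coordinate.
include hω in
theorem mem_Omega_diff_cell (hq : 0 < q) (hr : 0 < r) {S : Set (V K)} :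
    S ∈ Omega q ω r \ cell ω r (e K) ↔ ∃ (κ : Kˣ) (s t : K),
      s ^ (q + 1) + t + t ^ q = 0 ∧ S = pt ω r (κ • ![t, s, 1]) := by
  constructor
  · rintro ⟨⟨v, hv0, hv, rfl⟩, hc⟩
    by_cases h2 : v 2 = 0
    · exfalso
      have h1 : v 1 = 0 := by
        simpa [form, h2, hq.ne', ← pow_succ'] using hv
      apply hc
      rw [mem_cell hω hr]
      have h0 : v 0 ≠ 0 := by
        intro h0; apply hv0; ext i; fin_cases i <;> assumption
      refine ⟨Units.mk0 _ h0, ?_⟩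
      congr 1
      ext i; fin_cases i <;> simp [e, h1, h2, Units.smul_def]
    · have hv' : v = Units.mk0 _ h2 • ![v 0 / v 2, v 1 / v 2, 1] := by
        ext i; fin_cases i <;> simp [Units.smul_def, mul_div_cancel₀, h2]
      refine ⟨Units.mk0 _ h2, v 1 / v 2, v 0 / v 2, ?_, by rw [← hv']⟩
      rw [hv', form_affine] at hv
      exact (mul_eq_zero.1 hv).resolve_left (by simp [h2])
  · rintro ⟨κ, s, t, h, rfl⟩
    exact ⟨(pt_mem_Omega hω).2 ⟨affine_ne_zero κ s t, by rw [form_affine, h, mul_zero]⟩,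
      affine_not_mem_cell hω hr κ s t⟩

include hω in
theorem smul_pt {g : Equiv.Perm (V K)} {τ : K ≃+* K} (hg : ∀ (c : K) (v : V K), g (c • v) = τ c • g v)
    (v : V K) : g • pt ω r v = pt ω r (g v) := by
  have hu : ∀ (c : Kˣ) (v : V K), g (c • v) = Units.map (τ : K →* K) c • g v := fun c v => hg c v
  ext w
  rw [Set.mem_smul_set, mem_pt hω]
  constructor
  · rintro ⟨u, hu', rfl⟩
    obtain ⟨y, rfl⟩ := (mem_pt hω).1 hu'
    exact ⟨_, by rw [Equiv.Perm.smul_def, hu, map_pow]⟩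
  · rintro ⟨y, rfl⟩
    refine ⟨Units.map (τ.symm : K →* K) y ^ r • v, (mem_pt hω).2 ⟨_, rfl⟩, ?_⟩
    rw [Equiv.Perm.smul_def, hu, map_pow]
    congr 2
    ext; simp

end Points

/-! ### Elements of the groups -/

section Groups

variable {K : Type*} [Field K] {q : ℕ}

theorem exists_mem_ZSU (M : Matrix (Fin 3) (Fin 3) K) (hM : M.det = 1)
    (hf : ∀ u v, form q (M.mulVec u) (M.mulVec v) = form q u v) (k : Kˣ) :
    ∃ g ∈ ZSU K q, ∀ v, g v = k • M.mulVec v := by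
  let m := Matrix.SpecialLinearGroup.toLin' ⟨M, hM⟩
  have hm : ∀ v, m v = M.mulVec v := fun v => rfl
  have hS : m ∈ SU K q := by
    refine ⟨fun u v => by rw [hm, hm, hf], ?_⟩
    change LinearEquiv.det m = 1
    ext
    rw [LinearEquiv.coe_det]
    exact (LinearMap.det_toLin' M).trans hM
  refine ⟨MulAction.toPermHom Kˣ (V K) k * MulAction.toPermHom (V K ≃ₗ[K] V K) (V K) m,
    Subgroup.mul_mem_sup ⟨k, rfl⟩ (Subgroup.mem_map_of_mem _ hS), fun v => ?_⟩
  rfl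

theorem exists_affine_mem_ZSU (hK : IsQuadratic K q) (c : Kˣ) (s t : K)
    (hst : s ^ (q + 1) + t + t ^ q = 0) : ∃ g ∈ ZSU K q,
      (∀ (a : K) (v : V K), g (a • v) = a • g v) ∧ g (e K) = e K ∧ ∀ (κ : Kˣ) (s₁ t₁ : K),
        g (κ • ![t₁, s₁, 1]) = ((c ^ (q + 1))⁻¹ * κ) • ![t + c ^ (q + 1) * t₁ -
          c ^ (2 * q - 1) * s₁ * s ^ q, s + c ^ (2 * q - 1) * s₁, 1] := by
  obtain ⟨n, rfl⟩ : ∃ n, q = n + 1 := ⟨q - 1, by have := hK.two_le; omega⟩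
  have hc := c.ne_zero
  -- Here q = n + 1. `M₁` is the unipotent isometry taking f to f + sx + te, and `M₂` is the torus
  -- element diag(c, c^(q-1), c^(-q)). The final scalar c⁻¹ makes the product fix e; factoring out
  -- the f-coordinate c^(-(q+1)) leaves c^(2q-1) on s and c^(q+1) on t.
  let M₁ : Matrix (Fin 3) (Fin 3) K := !![1, -s ^ (n + 1), t; 0, 1, s; 0, 0, 1]
  let M₂ : Matrix (Fin 3) (Fin 3) K := !![(c : K), 0, 0; 0, c ^ n, 0; 0, 0, (c ^ (n + 1) : K)⁻¹]
  have h₁ : ∀ v, M₁.mulVec v = ![v 0 - s ^ (n + 1) * v 1 + t * v 2, v 1 + s * v 2, v 2] := by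
    intro v; ext i; fin_cases i <;> simp [M₁, Matrix.mulVec, dotProduct, Fin.sum_univ_three]; ring
  have h₂ : ∀ v, M₂.mulVec v = ![c * v 0, c ^ n * v 1, (c ^ (n + 1) : K)⁻¹ * v 2] := by
    intro v; ext i; fin_cases i <;> simp [M₂, Matrix.mulVec, dotProduct, Fin.sum_univ_three]
  have f₁ : ∀ u v, form (n + 1) (M₁.mulVec u) (M₁.mulVec v) = form (n + 1) u v := by
    intro u v
    rw [h₁, h₁]
    have i : s ^ (n + 1) * s + t + t ^ (n + 1) = 0 := by rw [← hst]; ring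
    have p1 : ∀ a b c : K, (a - b + c) ^ (n + 1) = a ^ (n + 1) - b ^ (n + 1) + c ^ (n + 1) :=
      fun a b c => by rw [hK.add_pow, hK.sub_pow]
    simp only [form, Matrix.cons_val, p1, hK.add_pow, mul_pow (M := K), hK.pow_pow]
    linear_combination (u 2 * v 2 ^ (n + 1)) * i
  have f₂ : ∀ u v, form (n + 1) (M₂.mulVec u) (M₂.mulVec v) = form (n + 1) u v := by
    intro u v
    rw [h₂, h₂]
    have i : ((c : K) ^ n) ^ (n + 1) * (c : K) ^ n = 1 := by
      have := hK.pow_pow (c : K)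
      rw [← mul_left_inj' hc, one_mul]
      nth_rw 4 [← this]
      ring
    have i' : (((c : K) ^ (n + 1))⁻¹) ^ (n + 1) = (c : K)⁻¹ := by
      rw [inv_pow, hK.pow_pow]
    simp only [form, Matrix.cons_val, mul_pow (M := K), i']
    field_simp
    linear_combination (u 1 * v 1 ^ (n + 1)) * i
  obtain ⟨g, hg, hgv⟩ := exists_mem_ZSU (q := n + 1) (M₁ * M₂)
    (by
      rw [Matrix.det_mul, Matrix.det_fin_three, Matrix.det_fin_three]
      simp [M₁, M₂]
      field_simp
      ring)
    (fun u v => by rw [← Matrix.mulVec_mulVec, ← Matrix.mulVec_mulVec, f₁, f₂]) c⁻¹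
  refine ⟨g, hg, fun a v => ?_, ?_, fun κ s₁ t₁ => ?_⟩
  · rw [hgv, hgv, Matrix.mulVec_smul, smul_comm]
  · rw [hgv, ← Matrix.mulVec_mulVec, h₁, h₂]
    ext i; fin_cases i <;> simp [e, Units.smul_def]
  · rw [hgv, ← Matrix.mulVec_mulVec, h₁, h₂]
    have e2 : 2 * (n + 1) - 1 = 2 * n + 1 := by omega
    ext i; fin_cases i <;> simp [Units.smul_def, e2] <;> field_simp <;> ring

end Groups

/-! ### The block in affine coordinates -/

section Block

variable {K : Type*} [Field K] {q r : ℕ} {ω : Kˣ} {G : Subgroup (Equiv.Perm (V K))}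
  {B : Set (Set (V K))}

theorem smul_mem_of_isBlock
    (hB : MulAction.IsBlock (MulAction.stabilizer G (pt ω r (e K))) B) {g : Equiv.Perm (V K)}
    (hg : g ∈ G) (hge : g • pt ω r (e K) = pt ω r (e K)) {S T : Set (V K)} (hS : S ∈ B)
    (hgS : g • S ∈ B) (hT : T ∈ B) : g • T ∈ B := by
  let g' : MulAction.stabilizer G (pt ω r (e K)) := ⟨⟨g, hg⟩, hge⟩
  have h := hB.smul_eq_of_mem (g := g') hS hgS
  rw [← h]
  exact Set.smul_mem_smul_set (a := g') hT

theorem affineBlock_of_isBlock (hK : IsQuadratic K q) (hω : Subgroup.zpowers ω = ⊤)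
    (hG : ZSU K q ≤ G) (hBsub : B ⊆ Omega q ω r \ cell ω r (e K))
    (hB : MulAction.IsBlock (MulAction.stabilizer G (pt ω r (e K))) B)
    (hfB : pt ω r (f K) ∈ B) :
    AffineBlock q r (fun κ s t => pt ω r (κ • ![t, s, 1]) ∈ B) where
  iso {κ s t} h := by
    have := ((pt_mem_Omega hω).1 (hBsub h).1).2
    rw [form_affine] at this
    exact (mul_eq_zero.1 this).resolve_left (by simp)
  base := by simpa [f] using hfB
  mul_pow h y := by
    rwa [(affine_pt_eq_iff hω).2 ⟨⟨y, rfl⟩, rfl, rfl⟩]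
  move c s t hst {κ₁ s₁ t₁} h1 h1' {κ₂ s₂ t₂} h2 := by
    obtain ⟨g, hg, hgl, hge, hgv⟩ := exists_affine_mem_ZSU hK c s t hst
    have hp : ∀ v, g • pt ω r v = pt ω r (g v) := smul_pt hω (τ := RingEquiv.refl K) hgl
    have := smul_mem_of_isBlock hB (hG hg) (by rw [hp, hge]) h1 (by rwa [hp, hgv]) h2
    rwa [hp, hgv] at this

end Block

/-! ### Consequences of the rank -/

/-- An invariant with three values on three orbits induces a surjection between sets of size three,
hence separates the orbits. -/
theorem exists_smul_eq_of_ncard_orbits {H T : Type*} [Group H] [MulAction H T] {X : Set T}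
    (c : T → Fin 3) (hc : ∀ (h : H) y, c (h • y) = c y) (hsurj : ∀ i, ∃ y ∈ X, c y = i)
    (h3 : {O : Set T | ∃ y ∈ X, O = MulAction.orbit H y}.ncard = 3) {y z : T} (hy : y ∈ X)
    (hz : z ∈ X) (hyz : c y = c z) : ∃ h : H, h • y = z := by
  set 𝒪 := {O : Set T | ∃ y ∈ X, O = MulAction.orbit H y}
  have hfin : 𝒪.Finite := Set.finite_of_ncard_ne_zero (by omega)
  have := hfin.to_subtype
  have hne : ∀ O : 𝒪, (O : Set T).Nonempty := by
    rintro ⟨O, w, -, rfl⟩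
    exact MulAction.nonempty_orbit w
  let F : 𝒪 → Fin 3 := fun O => c (hne O).some
  have hF : ∀ w (hw : w ∈ X), F ⟨MulAction.orbit H w, w, hw, rfl⟩ = c w := by
    intro w hw
    obtain ⟨h, hh⟩ := (hne ⟨MulAction.orbit H w, w, hw, rfl⟩).some_mem
    simp only [F]
    rw [← hh]
    exact hc h w
  have hbij := Function.Surjective.bijective_of_nat_card_le (f := F)
    (fun i => by
      obtain ⟨w, hw, hi⟩ := hsurj i
      exact ⟨_, (hF w hw).trans hi⟩)
    (by rw [Nat.card_coe_set_eq, h3, Nat.card_fin])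
  have h1 := hbij.1 ((hF y hy).trans (hyz.trans (hF z hz).symm))
  have h2 : MulAction.orbit H y = MulAction.orbit H z := congrArg Subtype.val h1
  have h3 : z ∈ MulAction.orbit H y := h2 ▸ MulAction.mem_orbit_self z
  exact h3

section Frobenius

theorem exists_eq_pow_of_ringEquiv {K : Type*} [Field K] [Finite K] {p : ℕ} (hp : p.Prime)
    [CharP K p] (τ : K ≃+* K) : ∃ j : ℕ, ∀ y, τ y = y ^ p ^ j := by
  have := Fact.mk hp
  let _ := ZMod.algebra K p
  let τ' : K →ₐ[ZMod p] K :=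
    { (τ : K →+* K) with
      commutes' := fun c => congrFun (congrArg DFunLike.coe (Subsingleton.elim
        ((τ : K →+* K).comp (algebraMap (ZMod p) K)) (algebraMap (ZMod p) K))) c }
  obtain ⟨n, hn⟩ := (FiniteField.bijective_frobeniusAlgHom_pow (ZMod p) K).2 τ'
  refine ⟨n, fun y => ?_⟩
  have := DFunLike.congr_fun hn y
  simp only [AlgHom.coe_pow, FiniteField.coe_frobeniusAlgHom, pow_iterate, ZMod.card] at this
  exact this.symm

end Frobenius

section Rank

variable {K : Type*} [Field K] {q r : ℕ} {ω : Kˣ} {G : Subgroup (Equiv.Perm (V K))}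

theorem dvd_of_zpow_eq_pow (hK : IsQuadratic K q) (hω : Subgroup.zpowers ω = ⊤)
    (hrq : r ∣ q ^ 2 - 1) {n : ℤ} {y : Kˣ} (h : ω ^ n = y ^ r) : (r : ℤ) ∣ n := by
  obtain ⟨m, rfl⟩ : y ∈ Subgroup.zpowers ω := hω ▸ Subgroup.mem_top y
  have ho : orderOf ω = q ^ 2 - 1 := by
    rw [← hK.card_units, orderOf_eq_card_of_forall_mem_zpowers (fun z => hω ▸ Subgroup.mem_top z)]
  simp only at h
  rw [← zpow_natCast, ← zpow_mul, ← mul_inv_eq_one, ← zpow_sub, ← orderOf_dvd_iff_zpow_eq_one, ho] at h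
  have h1 : (r : ℤ) ∣ n - m * r := (Int.natCast_dvd_natCast.2 hrq).trans h
  have := dvd_add h1 (Dvd.intro_left m rfl)
  rwa [sub_add_cancel] at this

open Classical in
/-- The class of a point with respect to the three orbits of the stabiliser of `⟨ω ^ r⟩ e`. -/
noncomputable def orbitClass (ω : Kˣ) (r : ℕ) (S : Set (V K)) : Fin 3 :=
  if S = pt ω r (e K) then 0 else if S ∈ cell ω r (e K) then 1 else 2

theorem smul_mem_cell (hω : Subgroup.zpowers ω = ⊤) (hr : 0 < r) {g : Equiv.Perm (V K)}
    (hg : g ∈ GammaU K q) (hge : g • pt ω r (e K) = pt ω r (e K)) {S : Set (V K)}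
    (hS : S ∈ cell ω r (e K)) : g • S ∈ cell ω r (e K) := by
  obtain ⟨-, ⟨τ, hτ⟩, -⟩ := hg
  obtain ⟨κ, rfl⟩ := (mem_cell hω hr).1 hS
  rw [smul_pt hω hτ] at hge ⊢
  obtain ⟨y, hy⟩ := (pt_eq_iff hω).1 hge
  refine (mem_cell hω hr).2 ⟨Units.map (τ : K →* K) κ * y ^ r, ?_⟩
  rw [mul_smul, ← hy]
  exact congrArg _ (hτ κ (e K))

theorem orbitClass_smul (hω : Subgroup.zpowers ω = ⊤) (hr : 0 < r) (hG : G ≤ GammaU K q)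
    (h : MulAction.stabilizer G (pt ω r (e K))) (S : Set (V K)) :
    orbitClass ω r (h • S) = orbitClass ω r S := by
  have key : ∀ (h : MulAction.stabilizer G (pt ω r (e K))) (S : Set (V K)),
      S ∈ cell ω r (e K) → h • S ∈ cell ω r (e K) := fun h S hS =>
    smul_mem_cell hω hr (hG h.1.2) h.2 hS
  have h1 : h • S = pt ω r (e K) ↔ S = pt ω r (e K) := by
    have : h • pt ω r (e K) = pt ω r (e K) := h.2
    rw [smul_eq_iff_eq_inv_smul, inv_smul_eq_iff.2 this.symm]
  have h2 : h • S ∈ cell ω r (e K) ↔ S ∈ cell ω r (e K) :=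
    ⟨fun hS => by simpa using key h⁻¹ _ hS, key h S⟩
  rw [orbitClass, orbitClass]
  by_cases a : S = pt ω r (e K)
  · rw [if_pos a, if_pos (h1.2 a)]
  · rw [if_neg a, if_neg (mt h1.1 a)]
    by_cases b : S ∈ cell ω r (e K)
    · rw [if_pos b, if_pos (h2.2 b)]
    · rw [if_neg b, if_neg (mt h2.1 b)]

theorem smul_affine_eq (κ : Kˣ) : κ • f K = κ • ![0, 0, 1] := rfl

theorem e_ne_zero : (e K) ≠ 0 := fun h => by simpa [e] using congrFun h 0

theorem exists_mem_of_hasRank (hK : IsQuadratic K q) (hω : Subgroup.zpowers ω = ⊤) (hr : 1 < r)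
    (hrq : r ∣ q ^ 2 - 1) (hG : G ≤ GammaU K q) (hrank : HasRank G (Omega q ω r) 3) :
    (∀ i : ℕ, ¬ r ∣ i → ∃ g ∈ G, g • pt ω r (e K) = pt ω r (e K) ∧
      g • pt ω r (ω • e K) = pt ω r (ω ^ i • e K)) ∧
    ∃ g ∈ G, g • pt ω r (e K) = pt ω r (e K) ∧ g • pt ω r (f K) = pt ω r (ω • f K) := by
  have hr0 : 0 < r := by omega
  have hq0 := hK.two_le
  have hsm : ∀ (κ : Kˣ), pt ω r (κ • e K) ∈ Omega q ω r := by
    intro κ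
    refine (pt_mem_Omega hω).2 ⟨fun h => e_ne_zero (K := K) (by simpa [smul_eq_zero_iff_eq] using h), ?_⟩
    rw [form_smul]; simp [form, e]; omega
  have hsf : ∀ (κ : Kˣ), pt ω r (κ • f K) ∈ Omega q ω r := by
    intro κ
    refine ((mem_Omega_diff_cell hω (by omega) hr0).2 ⟨κ, 0, 0, ?_, rfl⟩).1
    simp; omega
  have he := hsm 1
  rw [one_smul] at he
  have hp : ∀ i : ℕ, ¬ r ∣ i → pt ω r (ω ^ i • e K) ≠ pt ω r (e K) := by
    intro i hi h
    obtain ⟨y, hy⟩ := (pt_eq_iff hω).1 h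
    have h0 : ω ^ i = y ^ r := Units.ext (by simpa [e, Units.smul_def] using congrFun hy 0)
    exact hi (Int.natCast_dvd_natCast.1 (dvd_of_zpow_eq_pow hK hω hrq (n := i) (by simpa using h0)))
  have hc1 : ∀ i : ℕ, ¬ r ∣ i → orbitClass ω r (pt ω r (ω ^ i • e K)) = 1 := by
    intro i hi
    rw [orbitClass, if_neg (hp i hi), if_pos ((mem_cell hω hr0).2 ⟨_, rfl⟩)]
  have hc2 : ∀ κ : Kˣ, orbitClass ω r (pt ω r (κ • f K)) = 2 := by
    intro κ
    have h := affine_not_mem_cell hω hr0 κ 0 0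
    have h' : pt ω r (κ • ![0, 0, 1]) ≠ pt ω r (e K) := fun h' =>
      h (h' ▸ (mem_cell hω hr0).2 ⟨1, by rw [one_smul]⟩)
    rw [smul_affine_eq, orbitClass, if_neg h', if_neg h]
  have h1r : ¬ r ∣ 1 := fun h => by have := Nat.dvd_one.1 h; omega
  have hsurj : ∀ i, ∃ y ∈ Omega q ω r, orbitClass ω r y = i := by
    intro i
    fin_cases i
    · exact ⟨_, he, if_pos rfl⟩
    · exact ⟨_, hsm _, hc1 1 h1r⟩
    · exact ⟨_, hsf 1, hc2 1⟩
  have main := fun {y z : Set (V K)} => exists_smul_eq_of_ncard_orbits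
    (H := MulAction.stabilizer G (pt ω r (e K))) (orbitClass ω r)
    (orbitClass_smul hω hr0 hG) hsurj (hrank.2.2 _ he) (y := y) (z := z)
  refine ⟨fun i hi => ?_, ?_⟩
  · obtain ⟨h, hh⟩ := main (hsm (ω ^ 1)) (hsm (ω ^ i)) ((hc1 1 h1r).trans (hc1 i hi).symm)
    rw [pow_one] at hh
    exact ⟨h.1, h.1.2, h.2, hh⟩
  · obtain ⟨h, hh⟩ := main (hsf 1) (hsf ω) ((hc2 1).trans (hc2 ω).symm)
    rw [one_smul] at hh
    exact ⟨h.1, h.1.2, h.2, hh⟩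

/-- An element fixing ⟨ω^r⟩e and taking ωe to ω^i e scales e by an r-th power, so its field
automorphism must take ω to ω^i modulo r-th powers. -/
theorem exists_frobenius_of_hasRank [Finite K] {p : ℕ} (hp : p.Prime) [CharP K p]
    (hK : IsQuadratic K q) (hω : Subgroup.zpowers ω = ⊤) (hr : 1 < r)
    (hrq : r ∣ q ^ 2 - 1) (hG : G ≤ GammaU K q) (hrank : HasRank G (Omega q ω r) 3) {i : ℕ}
    (hi : ¬ r ∣ i) : ∃ g ∈ G, ∃ j : ℕ, (∀ (c : K) (v : V K), g (c • v) = c ^ p ^ j • g v) ∧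
      p ^ j ≡ i [MOD r] := by
  obtain ⟨g, hg, hge, hgi⟩ := (exists_mem_of_hasRank hK hω hr hrq hG hrank).1 i hi
  obtain ⟨-, ⟨τ, hτ⟩, -⟩ := hG hg
  obtain ⟨j, hj⟩ := exists_eq_pow_of_ringEquiv hp τ
  refine ⟨g, hg, j, fun c v => by rw [hτ, hj], ?_⟩
  rw [smul_pt hω hτ] at hge hgi
  obtain ⟨y, hy⟩ := (pt_eq_iff hω).1 hge
  obtain ⟨z, hz⟩ := (pt_eq_iff hω).1 hgi
  have h1 : g (ω • e K) = ω ^ p ^ j • y ^ r • e K := by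
    rw [← hy, Units.smul_def, hτ, hj, Units.smul_def, Units.val_pow_eq_pow_val]
  rw [h1] at hz
  have h2 : ω ^ p ^ j * y ^ r = z ^ r * ω ^ i :=
    Units.ext (by simpa [e, Units.smul_def] using congrFun hz 0)
  have h3 : ω ^ ((p ^ j : ℕ) - (i : ℕ) : ℤ) = (z * y⁻¹) ^ r := by
    rw [zpow_sub, zpow_natCast, zpow_natCast, mul_pow, inv_pow, mul_inv_eq_iff_eq_mul,
      mul_right_comm, eq_mul_inv_iff_mul_eq, h2]
  have := dvd_of_zpow_eq_pow hK hω hrq h3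
  exact ((Nat.modEq_iff_dvd).2 this).symm

/-- An element fixing ⟨ω^r⟩e and taking f to ωf (up to r-th powers) maps x to some mx. Comparing (x,
x) with (e, f) shows that ω^q is m^(q+1) times an r-th power. If r divided q + 1, it would also
divide q. -/
theorem not_dvd_of_hasRank (hK : IsQuadratic K q) (hω : Subgroup.zpowers ω = ⊤) (hr : 1 < r)
    (hrq : r ∣ q ^ 2 - 1) (hG : G ≤ GammaU K q) (hrank : HasRank G (Omega q ω r) 3) :
    ¬ r ∣ q + 1 := by
  intro hd
  obtain ⟨g, hg, hge, hgf⟩ := (exists_mem_of_hasRank hK hω hr hrq hG hrank).2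
  obtain ⟨-, ⟨τ, hτ⟩, c, hc, θ, hθ⟩ := hG hg
  rw [smul_pt hω hτ] at hge hgf
  obtain ⟨μ, hμ⟩ := (pt_eq_iff hω).1 hge
  obtain ⟨ν, hν⟩ := (pt_eq_iff hω).1 hgf
  have hq0 : q ≠ 0 := by have := hK.two_le; omega
  have h1 := hθ (x K) (e K)
  have h2 := hθ (x K) (f K)
  have h3 := hθ (x K) (x K)
  have h4 := hθ (e K) (f K)
  have hfe : ∀ w : V K, form q w (μ ^ r • e K) = w 2 * ((μ : K) ^ r) ^ q := by
    intro w; simp [form, e, Units.smul_def, hq0]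
  have hff : ∀ w : V K, form q w (ν ^ r • ω • f K) = w 0 * ((ν : K) ^ r * ω) ^ q := by
    intro w; simp [form, f, Units.smul_def, hq0]
  rw [hμ, hfe] at h1
  rw [hν, hff] at h2
  rw [hμ, hν, hff] at h4
  have z1 : form q (x K) (e K) = 0 := by simp [form, x, e, hq0]
  have z2 : form q (x K) (f K) = 0 := by simp [form, x, f, hq0]
  have z3 : form q (x K) (x K) = 1 := by simp [form, x, hq0]
  have z4 : form q (e K) (f K) = 1 := by simp [form, e, f, hq0]
  rw [z1, map_zero, mul_zero] at h1
  rw [z2, map_zero, mul_zero] at h2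
  rw [z3, map_one, mul_one] at h3
  rw [z4, map_one, mul_one] at h4
  have w2 : g (x K) 2 = 0 := by simpa [hq0] using h1
  have w0 : g (x K) 0 = 0 := by simpa [hq0] using h2
  rw [form, w0, w2] at h3
  simp only [zero_mul, add_zero, zero_add] at h3
  rw [← pow_succ'] at h3
  simp only [e, Units.smul_def, Pi.smul_apply, Matrix.cons_val_zero, smul_eq_mul, mul_one,
    Units.val_pow_eq_pow_val] at h4
  have hm : g (x K) 1 ≠ 0 := by
    intro h0; rw [h0] at h3; exact hc (by rw [← h3]; simp)
  set m := Units.mk0 _ hm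
  have h5 : μ ^ r * (ν ^ r * ω) ^ q = m ^ (q + 1) := by
    ext
    push_cast
    rw [h4, ← h3]
    rfl
  obtain ⟨k, hk⟩ := hd
  have h6 : ω ^ (q : ℤ) = (m ^ k * μ⁻¹ * (ν ^ q)⁻¹) ^ r := by
    rw [hk, mul_pow, ← pow_mul, mul_comm] at h5
    rw [zpow_natCast, mul_pow, mul_pow, inv_pow, inv_pow, ← pow_mul, ← pow_mul, mul_comm k r,
      mul_comm q r, ← h5, mul_inv_cancel_right, mul_comm (ν ^ (r * q)), mul_inv_cancel_right]
  have h7 : r ∣ q := Int.natCast_dvd_natCast.1 (dvd_of_zpow_eq_pow hK hω hrq h6)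
  have h8 : r ∣ 1 := (Nat.dvd_add_right h7).1 ⟨k, hk⟩
  have := Nat.dvd_one.1 h8
  omega

theorem admissible_of_hasRank [Finite K] {p a : ℕ} (hp : p.Prime) (hq : q = p ^ a)
    (hK : IsQuadratic K q) [CharP K p] (hω : Subgroup.zpowers ω = ⊤) (hr : 1 < r)
    (hrq : r ∣ q ^ 2 - 1) (hG : G ≤ GammaU K q) (hrank : HasRank G (Omega q ω r) 3) :
    Admissible q r ∧ r ≠ 2 ∧ r - 1 ∣ a := by
  have hnd := not_dvd_of_hasRank hK hω hr hrq hG hrank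
  have hq2 := hK.two_le
  have hfac : q ^ 2 - 1 = (q + 1) * (q - 1) := by
    have := Nat.sq_sub_sq q 1; simpa using this
  have hpow : ∀ i, ¬ r ∣ i → ∃ j, p ^ j ≡ i [MOD r] := fun i hi => by
    obtain ⟨_, _, j, _, hj⟩ := exists_frobenius_of_hasRank hp hK hω hr hrq hG hrank hi
    exact ⟨j, hj⟩
  have hcop : p.Coprime r := by
    have h1 : (q ^ 2).Coprime (q ^ 2 - 1) := by
      have h : 1 ≤ q ^ 2 := Nat.one_le_pow _ _ (by omega)
      have := Nat.coprime_self_add_right (m := q ^ 2 - 1) (n := 1)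
      rw [Nat.sub_add_cancel h] at this
      exact (this.2 (Nat.coprime_one_right _)).symm
    have h2 : (q ^ 2).Coprime r := h1.coprime_dvd_right hrq
    refine Nat.Coprime.coprime_dvd_left ?_ h2
    rw [hq, ← pow_mul]
    refine dvd_pow_self p ?_
    rintro h0
    rw [Nat.mul_eq_zero, or_iff_left (by norm_num)] at h0
    subst h0
    simp at hq; omega
  -- A proper divisor m of r is congruent modulo r to a power of p, hence prime to r, so m = 1.
  have hprime : r.Prime := by
    refine Nat.prime_def_lt.2 ⟨hr, fun m hm hmr => ?_⟩
    have hm0 : 0 < m := Nat.pos_of_dvd_of_pos hmr (by omega)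
    obtain ⟨j, hj⟩ := hpow m (fun h => by have := Nat.le_of_dvd hm0 h; omega)
    have h1 : r.gcd (p ^ j) = 1 := (hcop.pow_left j).symm
    have h2 := hj.gcd_eq
    rw [Nat.gcd_comm, h1, Nat.gcd_eq_left hmr] at h2
    exact h2.symm
  have hdvd : r ∣ q - 1 := by
    rw [hfac] at hrq
    exact (hprime.dvd_mul.1 hrq).resolve_left hnd
  have hr2 : r ≠ 2 := by
    rintro rfl; omega
  -- The class of p generates (ℤ/r)ˣ, and p^a = q ≡ 1 modulo r.
  have hra : r - 1 ∣ a := by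
    have := Fact.mk hprime
    let u : (ZMod r)ˣ := ZMod.unitOfCoprime p hcop
    have hu : (u : ZMod r) = p := ZMod.coe_unitOfCoprime p hcop
    have hgen : ∀ y : (ZMod r)ˣ, y ∈ Subgroup.zpowers u := by
      intro y
      obtain ⟨j, hj⟩ := hpow (y : ZMod r).val (fun h => y.ne_zero (by
        rw [← ZMod.natCast_zmod_val (y : ZMod r)]
        exact (ZMod.natCast_eq_zero_iff _ _).2 h))
      refine ⟨j, ?_⟩
      ext
      have := (ZMod.natCast_eq_natCast_iff _ _ _).2 hj
      simpa [hu] using this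
    have ho : orderOf u = r - 1 := by
      rw [orderOf_eq_card_of_forall_mem_zpowers hgen, Nat.card_eq_fintype_card,
        ZMod.card_units]
    rw [← ho]
    apply orderOf_dvd_of_pow_eq_one
    ext
    have : ((q - 1 : ℕ) : ZMod r) = 0 := (ZMod.natCast_eq_zero_iff _ _).2 hdvd
    rw [Nat.cast_sub (by omega), hq] at this
    push_cast at this
    rw [Units.val_pow_eq_pow_val, hu, Units.val_one]
    exact sub_eq_zero.1 this
  refine ⟨⟨hprime, hdvd, hnd, ?_⟩, hr2, hra⟩
  -- A common prime of q^2 - 1 and 2q - 1 can only be 3. As a is even, q is a square, so q ≡ 0 or 1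
  -- modulo 3 and 3 does not divide 2q - 1.
  have hev : 2 ∣ a := by
    have := (hprime.eq_two_or_odd).resolve_left hr2
    exact (show 2 ∣ r - 1 by omega).trans hra
  obtain ⟨b, rfl⟩ := hev
  have hsq : q = p ^ b * p ^ b := by rw [hq, ← pow_add, two_mul]
  refine Nat.Coprime.symm ?_
  refine Nat.coprime_of_dvd fun l hl h1 h2 => ?_
  have h3 : (l : ℤ) ∣ 3 := by
    have h1' : (l : ℤ) ∣ 2 * q - 1 := by
      have := Int.natCast_dvd_natCast.2 h1
      rwa [Nat.cast_sub (by omega)] at this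
    have h2' : (l : ℤ) ∣ q ^ 2 - 1 := by
      have := Int.natCast_dvd_natCast.2 h2
      rwa [Nat.cast_sub (Nat.one_le_pow _ _ (by omega)), Nat.cast_pow] at this
    have : (3 : ℤ) = (2 * q + 1) * (2 * q - 1) - 4 * (q ^ 2 - 1) := by ring
    rw [this]
    exact dvd_sub (h1'.mul_left _) (h2'.mul_left _)
  have h3' : l ∣ 3 := by exact_mod_cast h3
  have h4 : l = 3 := (Nat.prime_dvd_prime_iff_eq hl Nat.prime_three).1 h3'
  subst h4
  generalize p ^ b = m at hsq
  have h5 : q % 3 = 0 ∨ q % 3 = 1 := by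
    rw [hsq, Nat.mul_mod]
    have : m % 3 < 3 := Nat.mod_lt _ (by norm_num)
    interval_cases m % 3 <;> simp
  omega

end Rank

/-! ### Semisimilarities -/

section Similitude

variable {K : Type*} [Field K] {q : ℕ}

theorem form_self_pow (hK : IsQuadratic K q) (v : V K) : form q v v ^ q = form q v v := by
  simp only [form, hK.add_pow, mul_pow, hK.pow_pow]; ring

theorem form_smul_right (y : K) (u v : V K) : form q (y • u) (y • v) = y ^ (q + 1) * form q u v := by
  simp [form, mul_pow, pow_succ]; ring

theorem det_pow_of_form_mulVec (hK : IsQuadratic K q) (A : Matrix (Fin 3) (Fin 3) K) (c : K)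
    (hA : ∀ u v, form q (A.mulVec u) (A.mulVec v) = c * form q u v) :
    A.det ^ (q + 1) = c ^ 3 := by
  let J : Matrix (Fin 3) (Fin 3) K := !![0, 0, 1; 0, 1, 0; 1, 0, 0]
  have hq0 : q ≠ 0 := by have := hK.two_le; omega
  have h : A.transpose * J * A.map hK.conj = c • J := by
    ext i j
    have h1 := hA (Pi.single i 1) (Pi.single j 1)
    rw [Matrix.mulVec_single_one, Matrix.mulVec_single_one] at h1
    have h2 : (A.transpose * J * A.map hK.conj) i j = form q (A.col i) (A.col j) := by
      simp [Matrix.mul_apply, Fin.sum_univ_three, J, form, hK.conj_apply]; ring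
    rw [h2, h1]
    fin_cases i <;> fin_cases j <;> simp [form, J, hq0]
  have hJ : J.det = -1 := by simp [J, Matrix.det_fin_three]
  have h1 := congrArg Matrix.det h
  rw [Matrix.det_mul, Matrix.det_mul, Matrix.det_transpose, Matrix.det_smul, hJ,
    ← RingHom.mapMatrix_apply, ← RingHom.map_det, hK.conj_apply, Fintype.card_fin] at h1
  rw [pow_succ]
  linear_combination -h1

/-- It suffices to find a scalar y with y^(q+1) = c and y^3 = det h, since then y⁻¹h is in SU. A
norm preimage z of c satisfies the second equation up to an ε of norm one, which is a cube because 3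
does not divide q + 1. -/
theorem mem_ZSU_of_similitude (hK : IsQuadratic K q) (hq3 : q % 3 = 1) {h : Equiv.Perm (V K)}
    (hadd : ∀ u v, h (u + v) = h u + h v) (hsmul : ∀ (a : K) v, h (a • v) = a • h v)
    {c : K} (hc : c ≠ 0) (hf : ∀ u v, form q (h u) (h v) = c * form q u v) : h ∈ ZSU K q := by
  let A := LinearMap.toMatrix' ({ toFun := h, map_add' := hadd, map_smul' := hsmul } : V K →ₗ[K] V K)
  have hA : ∀ v, A.mulVec v = h v := fun v => LinearMap.toMatrix'_mulVec _ v
  have hd := det_pow_of_form_mulVec hK A c (fun u v => by rw [hA, hA, hf])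
  have hq0 : q ≠ 0 := by have := hK.two_le; omega
  have hcq : c ^ q = c := by
    have := form_self_pow hK (h (x K))
    rw [hf] at this
    simpa [form, x, hq0] using this
  obtain ⟨z, hz⟩ := hK.exists_norm_eq (y := Units.mk0 c hc) hcq
  have hd0 : A.det ≠ 0 := by
    intro h0
    rw [h0, zero_pow (by omega)] at hd
    exact pow_ne_zero 3 hc hd.symm
  set δ := Units.mk0 _ hd0
  have hδ : δ ^ (q + 1) = (z ^ (q + 1)) ^ 3 := by
    rw [hz]; ext; exact hd
  set ε := δ * (z ^ 3)⁻¹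
  have hε : ε ^ (q + 1) = 1 := by
    rw [mul_pow, hδ, inv_pow, ← pow_mul, ← pow_mul, mul_comm 3, mul_inv_cancel]
  -- From ε^(q+1) = 1 and 3n = q + 2 it follows that (ε^n)^3 = ε.
  obtain ⟨n, hn⟩ : ∃ n, q + 2 = n * 3 := ⟨(q + 2) / 3, by omega⟩
  set y := z * ε ^ n
  have hy1 : y ^ (q + 1) = Units.mk0 c hc := by
    rw [mul_pow, ← pow_mul, mul_comm n, pow_mul, hε, one_pow, mul_one, hz]
  have hy3 : y ^ 3 = δ := by
    rw [mul_pow, ← pow_mul, ← hn, show q + 2 = q + 1 + 1 from rfl, pow_succ ε, hε, one_mul,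
      mul_comm, inv_mul_cancel_right]
  have hy1' : (y : K) ^ (q + 1) = c := by
    rw [← Units.val_pow_eq_pow_val, hy1]; rfl
  have hy3' : (y : K) ^ 3 = A.det := by
    rw [← Units.val_pow_eq_pow_val, hy3]; rfl
  obtain ⟨g, hg, hgv⟩ := exists_mem_ZSU (q := q) ((y⁻¹ : Kˣ) • A)
    (by
      rw [Units.smul_def, Matrix.det_smul, Fintype.card_fin, ← hy3', ← mul_pow, Units.inv_mul,
        one_pow])
    (fun u v => by
      rw [Units.smul_def, Matrix.smul_mulVec, Matrix.smul_mulVec, form_smul_right, hA, hA, hf,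
        ← hy1', ← mul_assoc, ← mul_pow, Units.inv_mul, one_pow, one_mul]) y
  have : h = g := by
    ext1 v
    rw [hgv, Units.smul_def y⁻¹, Matrix.smul_mulVec, hA, ← Units.smul_def, smul_inv_smul]
  rwa [this]

/-- The permutation of the vectors that applies a field automorphism to the coordinates. -/
def coordPerm (τ : K ≃+* K) : Equiv.Perm (V K) := Equiv.piCongrRight fun _ => τ.toEquiv

theorem coordPerm_apply (τ : K ≃+* K) (v : V K) (i : Fin 3) : coordPerm τ v i = τ (v i) := rfl

theorem coordPerm_smul (τ : K ≃+* K) (c : K) (v : V K) :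
    coordPerm τ (c • v) = τ c • coordPerm τ v := by
  ext i; simp [coordPerm_apply]

theorem coordPerm_mem_GammaU (τ : K ≃+* K) : coordPerm τ ∈ GammaU K q :=
  ⟨fun u v => by ext i; simp [coordPerm_apply], ⟨τ, coordPerm_smul τ⟩, 1, one_ne_zero, τ,
    fun u v => by simp [form, coordPerm_apply]⟩

theorem pow_apply_smul {g : Equiv.Perm (V K)} {m : ℕ}
    (hg : ∀ (c : K) (v : V K), g (c • v) = c ^ m • g v) (n : ℕ) (c : K) (v : V K) :
    (g ^ n) (c • v) = c ^ m ^ n • (g ^ n) v := by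
  induction n with
  | zero => simp
  | succ n ih => rw [pow_succ', Equiv.Perm.mul_apply, ih, hg, ← pow_mul, ← pow_succ,
      Equiv.Perm.mul_apply]

/-- Dividing a semisimilarity by a suitable power of g leaves a linear similitude, which lies in
Z·SU. -/
theorem eq_GammaU_of_frobenius_mem [Finite K] {p : ℕ} (hp : p.Prime) [CharP K p]
    (hK : IsQuadratic K q) (hq3 : q % 3 = 1) {G : Subgroup (Equiv.Perm (V K))}
    (hG : ZSU K q ≤ G) (hG' : G ≤ GammaU K q) {g : Equiv.Perm (V K)} (hg : g ∈ G)
    (hgp : ∀ (c : K) (v : V K), g (c • v) = c ^ p • g v) : G = GammaU K q := by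
  refine le_antisymm hG' fun h hh => ?_
  obtain ⟨-, ⟨τ, hτ⟩, -⟩ := id hh
  obtain ⟨i, hi⟩ := exists_eq_pow_of_ringEquiv hp τ
  have hgi : g ^ i ∈ G := pow_mem hg i
  have hmem : h * (g ^ i)⁻¹ ∈ GammaU K q := mul_mem hh (inv_mem (hG' hgi))
  have hlin : ∀ (a : K) v, (h * (g ^ i)⁻¹) (a • v) = a • (h * (g ^ i)⁻¹) v := by
    intro a v
    obtain ⟨u, rfl⟩ := (g ^ i).surjective v
    obtain ⟨b, rfl⟩ := τ.surjective a
    rw [hi, ← pow_apply_smul hgp]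
    have hinv : ∀ w, (g ^ i)⁻¹ ((g ^ i) w) = w := fun w => (g ^ i).symm_apply_apply w
    simp only [Equiv.Perm.mul_apply, hinv, hτ, hi]
  obtain ⟨hadd, -, c, hc, θ, hθ⟩ := hmem
  have hq0 : q ≠ 0 := by have := hK.two_le; omega
  -- Comparing the values of the form at (ae, f) and (e, f) shows that a linear map has trivial
  -- companion automorphism.
  have hθ1 : ∀ a, θ a = a := by
    intro a
    have h1 := hθ (a • e K) (f K)
    have h2 := hθ (e K) (f K)
    have z1 : form q (a • e K) (f K) = a := by simp [form, e, f, hq0]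
    have z2 : form q (e K) (f K) = 1 := by simp [form, e, f, hq0]
    have z3 : ∀ u v : V K, form q (a • u) v = a * form q u v := by
      intro u v; simp [form]; ring
    rw [z1, hlin, z3, h2, z2, map_one, mul_one, mul_comm] at h1
    exact (mul_left_cancel₀ hc h1).symm
  have := mem_ZSU_of_similitude hK hq3 hadd hlin hc (fun u v => by rw [hθ, hθ1])
  have := mul_mem (hG this) hgi
  rwa [inv_mul_cancel_right] at this

theorem odd_of_two_pow_modEq {r j : ℕ} (hr : r = 3 ∨ r = 5) (hj : 2 ^ j ≡ 2 [MOD r]) :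
    ∃ k, j = 2 * k + 1 := by
  rcases Nat.even_or_odd' j with ⟨k, rfl | rfl⟩
  · exfalso
    rw [pow_mul] at hj
    norm_num at hj
    rcases hr with rfl | rfl
    · have : ∀ k, 4 ^ k % 3 = 1 := fun k => by
        induction k with
        | zero => norm_num
        | succ k ih => rw [pow_succ]; omega
      have := this k
      unfold Nat.ModEq at hj; omega
    · have : ∀ k, 4 ^ k % 5 = 1 ∨ 4 ^ k % 5 = 4 := fun k => by
        induction k with
        | zero => norm_num
        | succ k ih => rw [pow_succ]; omega
      have := this k
      unfold Nat.ModEq at hj; omega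
  · exact ⟨k, rfl⟩

/-- Some element of G has field automorphism y ↦ y^(2^j) with 2^j ≡ 2 modulo r, so j is odd. Its
j-th power has exponent j^2 ≡ 1 modulo 8, and y^(2^8) = y in K, so that power is semilinear over
squaring. -/
theorem eq_GammaU_of_hasRank [Finite K] [CharP K 2] {r : ℕ} {ω : Kˣ} (hK : IsQuadratic K q)
    (hqr : (q = 4 ∧ r = 3) ∨ (q = 16 ∧ r = 5)) (hω : Subgroup.zpowers ω = ⊤)
    {G : Subgroup (Equiv.Perm (V K))} (hG : ZSU K q ≤ G) (hG' : G ≤ GammaU K q)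
    (hrank : HasRank G (Omega q ω r) 3) : G = GammaU K q := by
  have hq3 : q % 3 = 1 := by rcases hqr with ⟨rfl, rfl⟩ | ⟨rfl, rfl⟩ <;> rfl
  have h256 : ∀ y : K, y ^ 2 ^ 8 = y := by
    intro y
    have := hK.pow_pow y
    rcases hqr with ⟨rfl, -⟩ | ⟨rfl, -⟩
    · rw [show 2 ^ 8 = 4 * 4 * 4 * 4 by norm_num, pow_mul, pow_mul, pow_mul, this, this]
    · rw [show 2 ^ 8 = 16 * 16 by norm_num, pow_mul, this]
  obtain ⟨g, hg, j, hgj, hj⟩ := exists_frobenius_of_hasRank (i := 2) Nat.prime_two hK hω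
    (by rcases hqr with ⟨rfl, rfl⟩ | ⟨rfl, rfl⟩ <;> norm_num)
    (by rcases hqr with ⟨rfl, rfl⟩ | ⟨rfl, rfl⟩ <;> norm_num) hG' hrank
    (by rcases hqr with ⟨rfl, rfl⟩ | ⟨rfl, rfl⟩ <;> norm_num)
  obtain ⟨k, rfl⟩ := odd_of_two_pow_modEq
    (by rcases hqr with ⟨rfl, rfl⟩ | ⟨rfl, rfl⟩ <;> simp) hj
  refine eq_GammaU_of_frobenius_mem Nat.prime_two hK hq3 hG hG' (pow_mem hg (2 * k + 1))
    fun c v => ?_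
  rw [pow_apply_smul hgj, ← pow_mul]
  congr 1
  obtain ⟨l, hl⟩ : ∃ l, (2 * k + 1) * (2 * k + 1) = 8 * l + 1 := by
    obtain ⟨l, hl⟩ := Nat.even_mul_succ_self k
    exact ⟨l, by nlinarith⟩
  have hiter : ∀ l, c ^ 2 ^ (8 * l) = c := fun l => by
    induction l with
    | zero => simp
    | succ l ih => rw [mul_add, pow_add, pow_mul, ih, mul_one, h256]
  rw [hl, pow_succ, pow_mul, hiter]

end Similitude

/-! ### The exceptional blocks in affine coordinates -/

section Exceptional

theorem sq_add_self_add_one_of_orderOf {K : Type*} [Field K] {ω : Kˣ} {n : ℕ}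
    (ho : orderOf ω = n * 3) (hn : 0 < n) : ((ω : K) ^ n) ^ 2 + (ω : K) ^ n + 1 = 0 := by
  have h3 : ((ω : K) ^ n) ^ 3 = 1 := by
    rw [← pow_mul, ← Units.val_pow_eq_pow_val, ← ho, pow_orderOf_eq_one, Units.val_one]
  have h1 : (ω : K) ^ n ≠ 1 := by
    intro h1
    have : ω ^ n = 1 := Units.ext (by simpa using h1)
    have := Nat.le_of_dvd hn (orderOf_dvd_of_pow_eq_one this)
    omega
  have h0 : ((ω : K) ^ n - 1) * (((ω : K) ^ n) ^ 2 + (ω : K) ^ n + 1) = 0 := by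
    linear_combination h3
  exact (mul_eq_zero.1 h0).resolve_left (sub_ne_zero.2 h1)

theorem cube_root_cases {K : Type*} [Field K] (h2 : (2 : K) = 0) {z : K} (hz : z ^ 2 + z + 1 = 0)
    {w : K} (hw : w ^ 4 = w) : w = 0 ∨ w = 1 ∨ w = z ∨ w = z ^ 2 := by
  have h : w * ((w - 1) * ((w - z) * (w - z ^ 2))) = 0 := by
    linear_combination hw + (w*(w-1)*(-w + z - 1)) * hz + (w*(w-1)*w + w^2 - w^3)*h2
  simpa [sub_eq_zero] using h

variable {K : Type*} [Field K] {D : Kˣ → K → K → Prop}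

/-- The trace-zero elements form 𝔽₄, whose only proper nonzero additive subgroup stable under
squaring is {0, 1}. -/
theorem AffineBlock.exceptional_four (h2 : (2 : K) = 0) (hD : AffineBlock 4 3 D)
    (hfrob : ∀ κ s t, D κ s t → D (κ ^ 2) (s ^ 2) (t ^ 2))
    (hs : ∀ κ s t, D κ s t → (∃ y : Kˣ, κ = y ^ 3) ∧ s = 0) (hne : ∃ t, t ≠ 0 ∧ D 1 0 t)
    (hW : ∃ t, t + t ^ 4 = 0 ∧ ¬ D 1 0 t) (κ : Kˣ) (s t : K) :
    D κ s t ↔ (∃ y : Kˣ, κ = y ^ 3) ∧ s = 0 ∧ (t = 0 ∨ t = 1) := by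
  have add : ∀ t t', D 1 0 t → D 1 0 t' → D 1 0 (t + t') := fun t t' h h' => by
    simpa using hD.compose_one h h'
  have frob : ∀ t, D 1 0 t → D 1 0 (t ^ 2) := fun t h => by simpa using hfrob _ _ _ h
  have i0 : ∀ t : K, t + t ^ 4 = 0 → t ^ 4 = t := fun t h => by linear_combination h - t * h2
  have key : ∀ t, D 1 0 t → t = 0 ∨ t = 1 := by
    intro t h
    by_contra! hc
    obtain ⟨w, hw, hn⟩ := hW
    have h4 : t ^ 4 = t := i0 t (by simpa using hD.iso h)
    have hz : t ^ 2 + t + 1 = 0 := by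
      have h0 : (t * (t - 1)) * (t ^ 2 + t + 1) = 0 := by linear_combination h4
      exact (mul_eq_zero.1 h0).resolve_left (mul_ne_zero hc.1 (sub_ne_zero.2 hc.2))
    apply hn
    rcases cube_root_cases h2 hz (i0 w hw) with rfl | rfl | rfl | rfl
    · exact hD.base
    · have := add _ _ h (frob _ h)
      rwa [show t + t ^ 2 = 1 by linear_combination hz - h2] at this
    · exact h
    · exact frob _ h
  obtain ⟨t₁, ht₁, h1⟩ := hne
  obtain rfl := (key _ h1).resolve_left ht₁
  constructor
  · intro h
    obtain ⟨⟨y, rfl⟩, rfl⟩ := hs _ _ _ h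
    exact ⟨⟨y, rfl⟩, rfl, key _ ((hD.pow_mem_iff y 0 t).1 h)⟩
  · rintro ⟨⟨y, rfl⟩, rfl, rfl | rfl⟩
    · exact (hD.pow_mem_iff y 0 0).2 hD.base
    · exact (hD.pow_mem_iff y 0 1).2 h1

/-- The t over κ = 1 form an 𝔽₄-subspace of 𝔽₁₆ stable under squaring. For t outside 𝔽₄ the pair t,
t^2 is a basis, so a proper nonzero such subspace is 𝔽₄. -/
theorem AffineBlock.exceptional_sixteen (hK : IsQuadratic K 16) (h2 : (2 : K) = 0)
    (hD : AffineBlock 16 5 D)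
    (hfrob : ∀ κ s t, D κ s t → D (κ ^ 2) (s ^ 2) (t ^ 2))
    (hs : ∀ κ s t, D κ s t → (∃ y : Kˣ, κ = y ^ 5) ∧ s = 0) (hne : ∃ t, t ≠ 0 ∧ D 1 0 t)
    (hW : ∃ t, t + t ^ 16 = 0 ∧ ¬ D 1 0 t) (κ : Kˣ) (s t : K) :
    D κ s t ↔ (∃ y : Kˣ, κ = y ^ 5) ∧ s = 0 ∧ t ^ 4 = t := by
  have add : ∀ t t', D 1 0 t → D 1 0 t' → D 1 0 (t + t') := fun t t' h h' => by
    simpa using hD.compose_one h h'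
  have frob : ∀ t, D 1 0 t → D 1 0 (t ^ 2) := fun t h => by simpa using hfrob _ _ _ h
  have i0 : ∀ t : K, t + t ^ 16 = 0 → t ^ 16 = t := fun t h => by linear_combination h - t * h2
  obtain ⟨ω, ho, -⟩ := AffineBlock.exists_generator hK
  -- 85 = 5 · 17 = r(q + 1), so z is the factor by which scaling by ω acts on t, and it has order 3.
  set z : K := (ω : K) ^ 85
  have hz : z ^ 2 + z + 1 = 0 := sq_add_self_add_one_of_orderOf (by rw [ho]; norm_num) (by norm_num)
  have zmul : ∀ t, D 1 0 t → D 1 0 (z * t) := fun t h => by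
    have := hD.scale hK h ω
    simpa [← pow_mul] using this
  have fmul : ∀ a t : K, a ^ 4 = a → D 1 0 t → D 1 0 (a * t) := by
    intro a t ha h
    rcases cube_root_cases h2 hz ha with rfl | rfl | rfl | rfl
    · simpa using hD.base
    · simpa using h
    · exact zmul _ h
    · rw [pow_two, mul_assoc]; exact zmul _ (zmul _ h)
  have key : ∀ t, D 1 0 t → t ^ 4 = t := by
    intro t h
    by_contra hc
    obtain ⟨w, hw, hn⟩ := hW
    have ht := i0 t (by simpa using hD.iso h)
    have hw := i0 w hw
    have ht0 : t ≠ 0 := by rintro rfl; simp at hc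
    -- Cramer's rule for w = at + bt^2 and its fourth power w^4 = at^4 + bt^8 has determinant d; the
    -- quotients below are a and b.
    set d := t ^ 9 + t ^ 6
    have hd : d ≠ 0 := by
      have : d = t ^ 5 * (t ^ 4 - t) := by linear_combination (t ^ 6) * h2
      rw [this]
      exact mul_ne_zero (pow_ne_zero _ ht0) (sub_ne_zero.2 hc)
    have hadd4 : ∀ a b : K, (a + b) ^ 4 = a ^ 4 + b ^ 4 := fun a b => by
      linear_combination (2 * a ^ 3 * b + 3 * a ^ 2 * b ^ 2 + 2 * a * b ^ 3) * h2
    have hd4 : d ^ 4 = d := by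
      rw [hadd4]
      have e1 : t ^ 36 = t ^ 6 := by
        calc t ^ 36 = (t ^ 16) ^ 2 * t ^ 4 := by ring
          _ = _ := by rw [ht]; ring
      have e2 : t ^ 24 = t ^ 9 := by
        calc t ^ 24 = t ^ 16 * t ^ 8 := by ring
          _ = _ := by rw [ht]; ring
      linear_combination e1 + e2
    have ha : ((w * t ^ 8 + w ^ 4 * t ^ 2) / d) ^ 4 = (w * t ^ 8 + w ^ 4 * t ^ 2) / d := by
      rw [div_pow, hd4, hadd4]
      congr 1
      linear_combination (w ^ 4 * (t ^ 16 + t)) * ht + t ^ 8 * hw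
    have hb : ((t * w ^ 4 + t ^ 4 * w) / d) ^ 4 = (t * w ^ 4 + t ^ 4 * w) / d := by
      rw [div_pow, hd4, hadd4]
      congr 1
      linear_combination t ^ 4 * hw + w ^ 4 * ht
    have := add _ _ (fmul _ _ ha h) (fmul _ _ hb (frob _ h))
    apply hn
    convert this using 1
    field_simp
    linear_combination (- t^3 * w^4) * h2
  obtain ⟨t₁, ht₁, h1⟩ := hne
  constructor
  · intro h
    obtain ⟨⟨y, rfl⟩, rfl⟩ := hs _ _ _ h
    exact ⟨⟨y, rfl⟩, rfl, key _ ((hD.pow_mem_iff y 0 t).1 h)⟩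
  · rintro ⟨⟨y, rfl⟩, rfl, ht⟩
    refine (hD.pow_mem_iff y 0 t).2 ?_
    have := fmul (t / t₁) t₁ (by rw [div_pow, ht, key _ h1]) h1
    rwa [div_mul_cancel₀ _ ht₁] at this

/-- The unique t over an element ζ of order 3 decides everything. Squaring and self-composition both
give the t over ζ^2, so t^2 = (1 + ζ^2)t = ζt. The root t = 0 leads to B₃ and t = ζ to B₅. -/
theorem AffineBlock.exceptional_complement (hK : IsQuadratic K 4) (hqr : Admissible 4 3)
    (h2 : (2 : K) = 0) (hD : AffineBlock 4 3 D)
    (hfrob : ∀ κ s t, D κ s t → D (κ ^ 2) (s ^ 2) (t ^ 2))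
    (hall : ∀ κ, ∃ t, D κ 0 t) (hs : ∀ κ s t, D κ s t → s = 0) (hP : ∀ t, D 1 0 t → t = 0) :
    (∀ κ s t, D κ s t ↔ s = 0 ∧ t = 0) ∨
    (∀ κ s t, D κ s t ↔ ∃ c : Kˣ, c ^ 3 = 1 ∧ (∃ y : Kˣ, κ = c * y ^ 3) ∧ s = 0 ∧
      t = (c : K)⁻¹ - 1) := by
  have uniq : ∀ {κ t t'}, D κ 0 t → D κ 0 t' → t' = t := by
    intro κ t t' h h'
    have := hP _ (by simpa using hD.translate hK h h' hD.base)
    exact sub_eq_zero.1 this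
  obtain ⟨ω, ho, hω⟩ := AffineBlock.exists_generator hK
  have h15 : ω ^ 15 = 1 := by
    rw [show 15 = 4 ^ 2 - 1 by norm_num, ← ho, pow_orderOf_eq_one]
  set ζ := ω ^ 5
  have h3 : ζ ^ 3 = 1 := by rw [← pow_mul, h15]
  have hnc : ¬ ∃ y : Kˣ, ζ = y ^ 3 := by
    rintro ⟨y, hy⟩
    have h0 : y ^ 15 = 1 := by
      rw [show 15 = 4 ^ 2 - 1 by norm_num, ← hK.card_units]
      have := hK.finite
      exact pow_card_eq_one'
    have : ω ^ 25 = 1 := by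
      rw [show 25 = 5 * 5 by norm_num, pow_mul]
      change ζ ^ 5 = 1
      rw [hy, ← pow_mul, h0]
    have := orderOf_dvd_of_pow_eq_one this
    rw [ho] at this
    norm_num at this
  have hz : (ζ : K) ^ 2 + ζ + 1 = 0 := by
    have h1 : (ζ : K) ≠ 1 := fun h1 => hnc ⟨1, by ext; simp [h1]⟩
    have h3' : (ζ : K) ^ 3 = 1 := by rw [← Units.val_pow_eq_pow_val, h3, Units.val_one]
    have h0 : ((ζ : K) - 1) * ((ζ : K) ^ 2 + ζ + 1) = 0 := by linear_combination h3'
    exact (mul_eq_zero.1 h0).resolve_left (sub_ne_zero.2 h1)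
  have hinv : (ζ : K)⁻¹ = (ζ : K) ^ 2 := by
    rw [inv_eq_iff_eq_inv, eq_comm, inv_eq_iff_eq_inv]
    refine eq_inv_of_mul_eq_one_left ?_
    linear_combination ((ζ : K) - 1) * hz
  obtain ⟨t, ht⟩ := hall ζ
  have ht2 : D (ζ ^ 2) 0 (t ^ 2) := by simpa using hfrob _ _ _ ht
  -- The torus parameter ω⁻¹ realises the scalar ζ = ω^5 as an inverse norm, as composition
  -- requires.
  have hc5 : ((ω⁻¹ ^ (4 + 1))⁻¹ : Kˣ) = ζ := by simp [ζ]
  have ht2' : D (ζ ^ 2) 0 (t + (ζ : K) ^ 2 * t) := by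
    have := hD.compose (c := ω⁻¹) (y := 1) (by rw [hc5]; simpa using ht) ht
    rw [hc5, ← sq] at this
    have e5 : (((ω⁻¹ : Kˣ) : K) ^ (4 + 1)) = (ζ : K) ^ 2 := by
      rw [← hinv, ← Units.val_inv_eq_inv_val, ← Units.val_pow_eq_pow_val]
      congr 1
    rw [e5] at this
    simpa using this
  have heq := uniq ht2 ht2'
  have ht0 : t * (t - ζ) = 0 := by
    linear_combination -heq + t * hz - t * ζ * h2
  have hcase : t = 0 ∨ t = ζ := by simpa [sub_eq_zero] using ht0
  have hκ : ∀ κ : Kˣ, ∃ n y, κ = ζ ^ n * y ^ 3 := fun κ =>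
    AffineBlock.exists_pow_mul_pow hK hqr ζ hnc κ
  have hκ' : ∀ κ : Kˣ, ∃ c y : Kˣ, κ = c * y ^ 3 ∧ c ^ 3 = 1 := fun κ => by
    obtain ⟨n, y, h⟩ := hκ κ
    exact ⟨ζ ^ n, y, h, by rw [← pow_mul, mul_comm, pow_mul, h3, one_pow]⟩
  have hroot : ∀ c : Kˣ, c ^ 3 = 1 → c = 1 ∨ c = ζ ∨ c = ζ ^ 2 := by
    intro c hc
    have h3' : (c : K) ^ 3 = 1 := by rw [← Units.val_pow_eq_pow_val, hc, Units.val_one]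
    have := (cube_root_cases h2 hz (w := c) (by rw [pow_succ, h3', one_mul])).resolve_left c.ne_zero
    exact this.imp (fun h => Units.ext h)
      (Or.imp (fun h => Units.ext h) fun h => Units.ext (by simpa using h))
  rcases hcase with rfl | rfl
  · left
    have h0 : ∀ κ, D κ 0 0 := by
      intro κ
      obtain ⟨c, y, rfl, hc⟩ := hκ' κ
      refine hD.mul_pow ?_ y
      rcases hroot c hc with rfl | rfl | rfl
      · exact hD.base
      · exact ht
      · simpa using ht2
    intro κ s t
    constructor
    · intro h
      obtain rfl := hs _ _ _ h
      exact ⟨rfl, uniq (h0 κ) h⟩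
    · rintro ⟨rfl, rfl⟩
      exact h0 κ
  · right
    have h0 : ∀ c : Kˣ, c ^ 3 = 1 → D c 0 ((c : K)⁻¹ - 1) := by
      intro c hc
      rcases hroot c hc with rfl | rfl | rfl
      · simpa using hD.base
      · rw [hinv]
        convert ht using 1
        linear_combination hz - (ζ + 1) * h2
      · convert ht2 using 1
        rw [Units.val_pow_eq_pow_val, ← inv_pow, hinv]
        linear_combination ((ζ : K) ^ 2 - ζ - 1) * hz + ζ * h2
    intro κ s t
    constructor
    · intro h
      obtain rfl := hs _ _ _ h
      obtain ⟨c, y, rfl, hc⟩ := hκ' κ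
      exact ⟨c, hc, ⟨y, rfl⟩, rfl, uniq (hD.mul_pow (h0 c hc) y) h⟩
    · rintro ⟨c, hc, ⟨y, rfl⟩, rfl, rfl⟩
      exact hD.mul_pow (h0 c hc) y

end Exceptional

/-! ### The blocks as sets of points -/

section Sets

variable {K : Type*} [Field K] {q r : ℕ} {ω : Kˣ}

theorem f_add_smul_e (b : K) : f K + b • e K = (1 : Kˣ) • ![b, 0, 1] := by
  ext i; fin_cases i <;> simp [f, e]

theorem affine_injective (hω : Subgroup.zpowers ω = ⊤) {s t s' t' : K}
    (h : pt ω r ((1 : Kˣ) • ![t, s, 1]) = pt ω r ((1 : Kˣ) • ![t', s', 1])) : s = s' ∧ t = t' :=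
  ((affine_pt_eq_iff hω).1 h).2

theorem B1_eq_image : B1 q ω r = (fun m : K × K => pt ω r ((1 : Kˣ) • ![m.2, m.1, 1])) ''
    {m | m.1 ^ (q + 1) + m.2 + m.2 ^ q = 0} := by
  have hv : ∀ a b : K, f K + (a • x K + b • e K) = (1 : Kˣ) • ![b, a, 1] := by
    intro a b; ext i; fin_cases i <;> simp [f, e, x]
  have hf : ∀ a b : K, form q ((1 : Kˣ) • ![b, a, 1]) ((1 : Kˣ) • ![b, a, 1]) =
      a ^ (q + 1) + b + b ^ q := by
    intro a b; rw [form_affine]; simp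
  ext S
  constructor
  · rintro ⟨v, hv', h, rfl⟩
    obtain ⟨a, b, rfl⟩ := Submodule.mem_span_pair.1 hv'
    rw [hv, hf] at h
    exact ⟨(a, b), h, by rw [hv]⟩
  · rintro ⟨⟨a, b⟩, h, rfl⟩
    exact ⟨a • x K + b • e K, Submodule.mem_span_pair.2 ⟨a, b, rfl⟩, by rw [hv, hf]; exact h,
      by rw [hv]⟩

theorem B2_eq_image : B2 q ω r = (fun b : K => pt ω r ((1 : Kˣ) • ![b, 0, 1])) ''
    {b | b + b ^ q = 0} := by
  ext S
  simp only [B2, f_add_smul_e, Set.mem_image, Set.mem_ofPred_eq, eq_comm]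

theorem B3_eq_image : B3 ω r = (fun i : ℕ => pt ω r (ω ^ i • ![0, 0, 1])) '' Set.Iio r := by
  ext S
  simp only [B3, f, Set.mem_image, Set.mem_ofPred_eq, eq_comm, Set.mem_Iio]

theorem B4_eq_image : B4 q ω r = (fun m : ℕ × K => pt ω r (ω ^ m.1 • ![m.2, 0, 1])) ''
    (Set.Iio r ×ˢ {b | b + b ^ q = 0}) := by
  ext S
  simp only [B4, Set.mem_iUnion, f_add_smul_e, one_smul, cell]
  constructor
  · rintro ⟨b, hb, i, hi, rfl⟩
    exact ⟨(i, b), ⟨hi, hb⟩, rfl⟩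
  · rintro ⟨⟨i, b⟩, ⟨hi, hb⟩, rfl⟩
    exact ⟨b, hb, i, hi, rfl⟩

theorem c_smul_f_add (c : Kˣ) :
    (c : K) • f K + (1 - (c : K)) • e K = c • ![(c : K)⁻¹ - 1, 0, 1] := by
  ext i; fin_cases i <;> simp [f, e, Units.smul_def, mul_sub]

theorem eq_of_pow_eq_pow_mul (hK : IsQuadratic K q) (hω : Subgroup.zpowers ω = ⊤)
    (hrq : r ∣ q ^ 2 - 1) {i j : ℕ} (hi : i < r) (hj : j < r) {y : Kˣ}
    (h : ω ^ i = ω ^ j * y ^ r) : i = j := by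
  have h1 : ω ^ ((i : ℤ) - j) = y ^ r := by
    rw [zpow_sub, zpow_natCast, zpow_natCast, h, mul_comm, inv_mul_cancel_left]
  obtain ⟨m, hm⟩ := dvd_of_zpow_eq_pow hK hω hrq h1
  have hm0 : m = 0 := by
    by_contra hne
    rcases lt_or_gt_of_ne hne with h | h <;> nlinarith
  rw [hm0] at hm; omega

/-- Shifting t by z·s^(q+1), with z of trace one, turns the set into a product of K with the
trace-zero elements. -/
theorem ncard_iso (hK : IsQuadratic K q) :
    {m : K × K | m.1 ^ (q + 1) + m.2 + m.2 ^ q = 0}.ncard = q ^ 3 := by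
  have := hK.finite
  obtain ⟨z, hz⟩ := hK.exists_trace_one
  have hN : ∀ s : K, (s ^ (q + 1)) ^ q = s ^ (q + 1) := fun s => by
    rw [pow_succ, mul_pow, hK.pow_pow, mul_comm]
  have : {m : K × K | m.1 ^ (q + 1) + m.2 + m.2 ^ q = 0} =
      (fun m : K × K => (m.1, m.2 - z * m.1 ^ (q + 1))) '' (Set.univ ×ˢ {b | b + b ^ q = 0}) := by
    ext ⟨s, t⟩
    constructor
    · intro h
      refine ⟨(s, t + z * s ^ (q + 1)), ⟨trivial, ?_⟩, by simp⟩
      simp only [Set.mem_ofPred_eq] at h ⊢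
      rw [hK.add_pow, mul_pow, hN]
      linear_combination h + s ^ (q + 1) * hz
    · rintro ⟨⟨s', b⟩, ⟨-, hb⟩, h⟩
      simp only [Set.mem_ofPred_eq, Prod.mk.injEq] at h hb ⊢
      obtain ⟨rfl, rfl⟩ := h
      rw [hK.sub_pow, mul_pow, hN]
      linear_combination hb - s' ^ (q + 1) * hz
  rw [this, Set.ncard_image_of_injective, Set.ncard_prod, Set.ncard_univ, hK.card,
    hK.ncard_fixed_and_trace_zero.2]
  · ring
  · rintro ⟨s, t⟩ ⟨s', t'⟩ h
    simp only [Prod.mk.injEq] at h ⊢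
    obtain ⟨rfl, h⟩ := h
    exact ⟨rfl, sub_left_injective h⟩

theorem ncard_B1 (hK : IsQuadratic K q) (hω : Subgroup.zpowers ω = ⊤) :
    (B1 q ω r).ncard = q ^ 3 := by
  rw [B1_eq_image, Set.ncard_image_of_injective, ncard_iso hK]
  rintro ⟨s, t⟩ ⟨s', t'⟩ h
  obtain ⟨rfl, rfl⟩ := affine_injective hω h
  rfl

theorem ncard_B2 (hK : IsQuadratic K q) (hω : Subgroup.zpowers ω = ⊤) :
    (B2 q ω r).ncard = q := by
  rw [B2_eq_image, Set.ncard_image_of_injective, hK.ncard_fixed_and_trace_zero.2]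
  exact fun t t' h => (affine_injective hω h).2

theorem ncard_Iio (r : ℕ) : (Set.Iio r).ncard = r := by
  rw [← Finset.coe_Iio, Set.ncard_coe_finset, Nat.card_Iio]

theorem ncard_B3 (hK : IsQuadratic K q) (hω : Subgroup.zpowers ω = ⊤) (hrq : r ∣ q ^ 2 - 1) :
    (B3 ω r).ncard = r := by
  rw [B3_eq_image, Set.InjOn.ncard_image, ncard_Iio]
  intro i hi j hj h
  obtain ⟨⟨y, hy⟩, -⟩ := (affine_pt_eq_iff hω).1 h
  exact eq_of_pow_eq_pow_mul hK hω hrq hi hj hy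

theorem ncard_B4 (hK : IsQuadratic K q) (hω : Subgroup.zpowers ω = ⊤) (hrq : r ∣ q ^ 2 - 1) :
    (B4 q ω r).ncard = q * r := by
  rw [B4_eq_image, Set.InjOn.ncard_image, Set.ncard_prod, ncard_Iio,
    hK.ncard_fixed_and_trace_zero.2, mul_comm]
  rintro ⟨i, b⟩ ⟨hi, -⟩ ⟨j, b'⟩ ⟨hj, -⟩ h
  obtain ⟨⟨y, hy⟩, -, rfl⟩ := (affine_pt_eq_iff hω).1 h
  exact Prod.ext (eq_of_pow_eq_pow_mul hK hω hrq hi hj hy) rfl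

theorem ncard_B5 (hK : IsQuadratic K 4) (h2 : (2 : K) = 0) (hω : Subgroup.zpowers ω = ⊤) :
    (B5 ω r).ncard = 3 := by
  have := hK.finite
  have h : B5 ω r = (fun c : K => pt ω r (c • f K + (1 - c) • e K)) ''
      ({c | c + c ^ 4 = 0} \ {0}) := by
    ext S
    constructor
    · rintro ⟨c, h4, h0, rfl⟩
      exact ⟨c, ⟨by rw [Set.mem_ofPred_eq, h4]; linear_combination c * h2, h0⟩, rfl⟩
    · rintro ⟨c, ⟨h4, h0⟩, rfl⟩
      rw [Set.mem_ofPred_eq] at h4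
      exact ⟨c, by linear_combination h4 - c * h2, h0, rfl⟩
  rw [h, Set.InjOn.ncard_image, Set.ncard_sdiff_singleton_of_mem,
    hK.ncard_fixed_and_trace_zero.2]
  · simp
  · rintro c ⟨-, hc⟩ c' ⟨-, hc'⟩ h
    lift c to Kˣ using IsUnit.mk0 c hc
    lift c' to Kˣ using IsUnit.mk0 c' hc'
    simp only [c_smul_f_add] at h
    exact inv_injective (sub_left_injective ((affine_pt_eq_iff hω).1 h).2.2)

theorem ncard_B6 (hω : Subgroup.zpowers ω = ⊤) : (B6 ω r : Set (Set (V K))).ncard = 2 := by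
  refine Set.ncard_pair fun h => ?_
  have h0 := f_add_smul_e (0 : K)
  have h1 := f_add_smul_e (1 : K)
  rw [zero_smul, add_zero] at h0
  rw [one_smul] at h1
  rw [h1, h0] at h
  exact zero_ne_one (affine_injective hω h).2

theorem ncard_B7 (hK : IsQuadratic K 16) (h2 : (2 : K) = 0) (hω : Subgroup.zpowers ω = ⊤) :
    (B7 ω r : Set (Set (V K))).ncard = 4 := by
  have h : B7 ω r = (fun b : K => pt ω r ((1 : Kˣ) • ![b, 0, 1])) '' {c | c ^ 4 = c} := by
    ext S
    simp only [B7, f_add_smul_e, Set.mem_image, Set.mem_ofPred_eq, eq_comm]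
  obtain ⟨ω', ho, -⟩ := AffineBlock.exists_generator hK
  have hz := sq_add_self_add_one_of_orderOf (n := 85) (by rw [ho]; norm_num) (by norm_num)
  set z := (ω' : K) ^ 85
  have hz0 : z ≠ 0 := by rintro h; rw [h] at hz; simp at hz
  have hz1 : z ≠ 1 := by
    rintro h; rw [h] at hz
    exact one_ne_zero (by linear_combination hz - h2)
  have hzz : z ^ 2 ≠ 1 := by
    intro h
    exact hz0 (by linear_combination hz - h - h2)
  have hF : {c : K | c ^ 4 = c} = {0, 1, z, z ^ 2} := by
    ext c
    refine ⟨fun h => cube_root_cases h2 hz h, ?_⟩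
    have h3 : z ^ 3 = 1 := by linear_combination (z - 1) * hz
    rintro (rfl | rfl | rfl | rfl)
    · simp
    · simp
    · simp only [Set.mem_ofPred_eq]; linear_combination z * h3
    · simp only [Set.mem_ofPred_eq]; linear_combination (z ^ 3 + 1) * z ^ 2 * h3
  have hzs : z ≠ z ^ 2 := fun h => hz1 (by
    have : z * (z - 1) = 0 := by linear_combination -h
    exact sub_eq_zero.1 ((mul_eq_zero.1 this).resolve_left hz0))
  rw [h, Set.ncard_image_of_injective _ fun t t' h => (affine_injective hω h).2, hF,
    Set.ncard_insert_of_notMem, Set.ncard_insert_of_notMem, Set.ncard_pair hzs]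
  · simp [hz1.symm, hzz.symm]
  · simp [hz0.symm, (pow_ne_zero 2 hz0).symm]

end Sets

end UnitaryRankThree


theorem theorem5p2 {K : Type*} [Field K] [Finite K] (p a q r : ℕ) (hp : p.Prime) (ha : 1 ≤ a)
    (hq : q = p ^ a) (hq3 : 3 ≤ q) (hK : Nat.card K = q ^ 2)
    (ω : Kˣ) (hω : Subgroup.zpowers ω = ⊤) (hr : 1 < r) (hrq : r ∣ q ^ 2 - 1)
    (G : Subgroup (Equiv.Perm (UnitaryRankThree.V K)))
    (hG : UnitaryRankThree.ZSU K q ≤ G) (hG' : G ≤ UnitaryRankThree.GammaU K q)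
    (hrank : UnitaryRankThree.HasRank G (UnitaryRankThree.Omega q ω r) 3)
    (B : Set (Set (UnitaryRankThree.V K)))
    (hBsub : B ⊆ UnitaryRankThree.Omega q ω r \
      UnitaryRankThree.cell ω r (UnitaryRankThree.e K))
    (hBblock : MulAction.IsBlock
      (MulAction.stabilizer G (UnitaryRankThree.pt ω r (UnitaryRankThree.e K))) B)
    (hfB : UnitaryRankThree.pt ω r (UnitaryRankThree.f K) ∈ B)
    (hBnontrivial : B.Nontrivial)
    (hBproper : B ≠ UnitaryRankThree.Omega q ω r \
      UnitaryRankThree.cell ω r (UnitaryRankThree.e K)) :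
    (B = UnitaryRankThree.B1 q ω r ∧ B.ncard = q ^ 3) ∨
    (B = UnitaryRankThree.B2 q ω r ∧ B.ncard = q) ∨
    (B = UnitaryRankThree.B3 ω r ∧ B.ncard = r) ∨
    (B = UnitaryRankThree.B4 q ω r ∧ B.ncard = q * r) ∨
    (q = 4 ∧ r = 3 ∧ G = UnitaryRankThree.GammaU K q ∧
      ((B = UnitaryRankThree.B5 ω r ∧ B.ncard = 3) ∨
       (B = UnitaryRankThree.B6 ω r ∧ B.ncard = 2))) ∨
    (q = 16 ∧ r = 5 ∧ G = UnitaryRankThree.GammaU K q ∧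
      B = UnitaryRankThree.B7 ω r ∧ B.ncard = 4) := by
  open UnitaryRankThree in
  have hQ := IsQuadratic.of_prime_pow hp ha hq hK
  have hchar : CharP K p := charP_of_card hp (n := a * 2) (by rw [hK, hq, pow_mul])
  obtain ⟨hqr, hr2, hra⟩ := admissible_of_hasRank hp hq hQ hω hr hrq hG' hrank
  have hD := affineBlock_of_isBlock hQ hω hG hBsub hBblock hfB
  set D : Kˣ → K → K → Prop := fun κ s t => pt ω r (κ • ![t, s, 1]) ∈ B
  have hr0 : 0 < r := by omega
  have hB : ∀ S, S ∈ B ↔ ∃ κ s t, D κ s t ∧ S = pt ω r (κ • ![t, s, 1]) := by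
    intro S
    constructor
    · intro h
      obtain ⟨κ, s, t, -, rfl⟩ := (mem_Omega_diff_cell hω (by omega) hr0).1 (hBsub h)
      exact ⟨κ, s, t, h, rfl⟩
    · rintro ⟨κ, s, t, h, rfl⟩
      exact h
  have hpow : ∀ (y : Kˣ) (v : V K), pt ω r (y ^ r • v) = pt ω r ((1 : Kˣ) • v) := fun y v => by
    rw [pt_pow_smul hω, one_smul]
  have hκ : ∀ (κ : Kˣ) (v : V K), ∃ i < r, pt ω r (κ • v) = pt ω r (ω ^ i • v) := fun κ v =>
    (mem_cell hω hr0).2 ⟨κ, rfl⟩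
  have hone : ∃ y : Kˣ, (1 : Kˣ) = y ^ r := ⟨1, by simp⟩
  have hne : ∃ κ s t, D κ s t ∧ ¬ ((∃ y : Kˣ, κ = y ^ r) ∧ s = 0 ∧ t = 0) := by
    obtain ⟨S, hS, hSf⟩ := hBnontrivial.exists_ne (pt ω r (f K))
    obtain ⟨κ, s, t, h, rfl⟩ := (hB S).1 hS
    refine ⟨κ, s, t, h, ?_⟩
    rintro ⟨⟨y, rfl⟩, rfl, rfl⟩
    exact hSf (by rw [pt_pow_smul hω]; rfl)
  have hproper : ∃ (κ : Kˣ) (s t : K), s ^ (q + 1) + t + t ^ q = 0 ∧ ¬ D κ s t := by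
    by_contra! hc
    refine hBproper (hBsub.antisymm fun S hS => ?_)
    obtain ⟨κ, s, t, h, rfl⟩ := (mem_Omega_diff_cell hω (by omega) hr0).1 hS
    exact hc κ s t h
  have hB3 : (∀ κ s t, D κ s t ↔ s = 0 ∧ t = 0) → B = B3 ω r ∧ B.ncard = r := by
    intro h
    have : B = B3 ω r := by
      rw [B3_eq_image]
      ext S
      simp only [hB, h, Set.mem_image, Set.mem_Iio]
      constructor
      · rintro ⟨κ, _, _, ⟨rfl, rfl⟩, rfl⟩
        obtain ⟨i, hi, h⟩ := hκ κ ![0, 0, 1]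
        exact ⟨i, hi, h.symm⟩
      · rintro ⟨i, -, rfl⟩
        exact ⟨ω ^ i, 0, 0, ⟨rfl, rfl⟩, rfl⟩
    exact ⟨this, this ▸ ncard_B3 hQ hω hrq⟩
  have exceptional : q < r ^ 2 → ((q = 4 ∧ r = 3) ∨ (q = 16 ∧ r = 5)) ∧ (2 : K) = 0 ∧
      G = GammaU K q ∧ ∀ κ s t, D κ s t → D (κ ^ 2) (s ^ 2) (t ^ 2) := by
    intro hlt
    have hpar := exceptional_parameters hp ha hqr.prime hr2 hra (hq ▸ hlt)
    have hp2 : p = 2 := by rcases hpar with h | h <;> exact h.1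
    subst hp2
    have hqr' : (q = 4 ∧ r = 3) ∨ (q = 16 ∧ r = 5) := by
      rcases hpar with ⟨-, rfl, h⟩ | ⟨-, rfl, h⟩
      · exact .inl ⟨by rw [hq]; norm_num, h⟩
      · exact .inr ⟨by rw [hq]; norm_num, h⟩
    have hGU := eq_GammaU_of_hasRank hQ hqr' hω hG hG' hrank
    refine ⟨hqr', by exact_mod_cast CharP.cast_eq_zero K 2, hGU, fun κ s t h => ?_⟩
    have := Fact.mk hp
    -- The coordinate Frobenius map fixes both e and f, so it lies in the stabiliser and preserves
    -- B.
    have hg : coordPerm (frobeniusEquiv K 2) ∈ G := hGU ▸ coordPerm_mem_GammaU _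
    have hpt := smul_pt (r := r) hω (coordPerm_smul (frobeniusEquiv K 2))
    have hv : ∀ (κ : Kˣ) (s t : K), coordPerm (frobeniusEquiv K 2) (κ • ![t, s, 1]) =
        κ ^ 2 • ![t ^ 2, s ^ 2, 1] := by
      intro κ s t
      ext i
      fin_cases i <;> simp [coordPerm_apply, Units.smul_def, frobeniusEquiv_apply, frobenius_def, mul_pow]
    have he : coordPerm (frobeniusEquiv K 2) (e K) = e K := by
      ext i; fin_cases i <;> simp [coordPerm_apply, e]
    have h1 := smul_mem_of_isBlock hBblock hg (by rw [hpt, he]) hD.base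
      (by rw [hpt, hv, one_pow, zero_pow two_ne_zero]; exact hD.base) h
    rwa [hpt, hv] at h1
  rcases hD.classification hQ hqr hne hproper with h | h | h | h | ⟨hlt, hs, hex, hW⟩ |
    ⟨hr1, hall, hs, hP⟩
  · left
    have : B = B1 q ω r := by
      rw [B1_eq_image]
      ext S
      simp only [hB, h, Set.mem_image, Prod.exists]
      constructor
      · rintro ⟨_, s, t, ⟨⟨y, rfl⟩, h⟩, rfl⟩
        exact ⟨s, t, h, (hpow _ _).symm⟩
      · rintro ⟨s, t, h, rfl⟩
        exact ⟨1, s, t, ⟨hone, h⟩, rfl⟩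
    exact ⟨this, this ▸ ncard_B1 hQ hω⟩
  · right; left
    have : B = B2 q ω r := by
      rw [B2_eq_image]
      ext S
      simp only [hB, h, Set.mem_image]
      constructor
      · rintro ⟨_, _, t, ⟨⟨y, rfl⟩, rfl, h⟩, rfl⟩
        exact ⟨t, h, (hpow _ _).symm⟩
      · rintro ⟨t, h, rfl⟩
        exact ⟨1, 0, t, ⟨hone, rfl, h⟩, rfl⟩
    exact ⟨this, this ▸ ncard_B2 hQ hω⟩
  · exact .inr (.inr (.inl (hB3 h)))
  · right; right; right; left
    have : B = B4 q ω r := by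
      rw [B4_eq_image]
      ext S
      simp only [hB, h, Set.mem_image, Prod.exists]
      constructor
      · rintro ⟨κ, _, t, ⟨rfl, h⟩, rfl⟩
        obtain ⟨i, hi, h'⟩ := hκ κ ![t, 0, 1]
        exact ⟨i, t, ⟨hi, h⟩, h'.symm⟩
      · rintro ⟨i, t, ⟨-, h⟩, rfl⟩
        exact ⟨ω ^ i, 0, t, ⟨rfl, h⟩, rfl⟩
    exact ⟨this, this ▸ ncard_B4 hQ hω hrq⟩
  · right; right; right; right
    obtain ⟨hcase, h2, hGU, hfrob⟩ := exceptional hlt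
    rcases hcase with ⟨rfl, rfl⟩ | ⟨rfl, rfl⟩
    · left
      refine ⟨rfl, rfl, hGU, .inr ?_⟩
      have h := hD.exceptional_four h2 hfrob hs hex hW
      have : B = B6 ω 3 := by
        have h0 := f_add_smul_e (0 : K)
        have h1 := f_add_smul_e (1 : K)
        rw [zero_smul, add_zero] at h0
        rw [one_smul] at h1
        ext S
        simp only [hB, h, B6, h1]
        simp only [h0, Set.mem_insert_iff, Set.mem_singleton_iff]
        constructor
        · rintro ⟨_, _, _, ⟨⟨y, rfl⟩, rfl, rfl | rfl⟩, rfl⟩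
          · exact .inl (hpow _ _)
          · exact .inr (hpow _ _)
        · rintro (rfl | rfl)
          · exact ⟨1, 0, 0, ⟨hone, rfl, .inl rfl⟩, rfl⟩
          · exact ⟨1, 0, 1, ⟨hone, rfl, .inr rfl⟩, rfl⟩
      exact ⟨this, this ▸ ncard_B6 hω⟩
    · right
      refine ⟨rfl, rfl, hGU, ?_⟩
      have h := hD.exceptional_sixteen hQ h2 hfrob hs hex hW
      have : B = B7 ω 5 := by
        ext S
        simp only [hB, h, B7, f_add_smul_e, Set.mem_ofPred_eq]
        constructor
        · rintro ⟨_, _, t, ⟨⟨y, rfl⟩, rfl, h⟩, rfl⟩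
          exact ⟨t, h, hpow _ _⟩
        · rintro ⟨t, h, rfl⟩
          exact ⟨1, 0, t, ⟨hone, rfl, h⟩, rfl⟩
      exact ⟨this, this ▸ ncard_B7 hQ h2 hω⟩
  -- In this case q = r + 1 < r^2, so the exceptional analysis applies; q = 16, r = 5 is then
  -- excluded by q = r + 1.
  · have hlt : q < r ^ 2 := by
      have := hqr.prime.two_le
      nlinarith
    obtain ⟨hcase, h2, hGU, hfrob⟩ := exceptional hlt
    rcases hcase with ⟨rfl, rfl⟩ | ⟨rfl, rfl⟩
    · rcases hD.exceptional_complement hQ hqr h2 hfrob hall hs hP with h | h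
      · exact .inr (.inr (.inl (hB3 h)))
      · right; right; right; right; left
        refine ⟨rfl, rfl, hGU, .inl ?_⟩
        have : B = B5 ω 3 := by
          ext S
          simp only [hB, h, B5, Set.mem_ofPred_eq]
          constructor
          · rintro ⟨_, _, _, ⟨c, hc, ⟨y, rfl⟩, rfl, rfl⟩, rfl⟩
            refine ⟨c, ?_, c.ne_zero, ?_⟩
            · rw [pow_succ, ← Units.val_pow_eq_pow_val, hc, Units.val_one, one_mul]
            · rw [c_smul_f_add, mul_comm, mul_smul, pt_pow_smul hω]
          · rintro ⟨c, hc4, hc0, rfl⟩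
            refine ⟨Units.mk0 c hc0, 0, c⁻¹ - 1, ⟨Units.mk0 c hc0, ?_, ⟨1, by simp⟩, rfl, rfl⟩, ?_⟩
            · ext
              rw [pow_succ] at hc4
              simpa using mul_eq_right₀ hc0 |>.1 hc4
            · exact congrArg _ (c_smul_f_add (Units.mk0 c hc0))
        exact ⟨this, this ▸ ncard_B5 hQ h2 hω⟩
    · omega
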